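/- Let $l>0$, $I=(-\tfrac l2,\tfrac l2)$, $S=I\times(-\tfrac12,\tfrac12)$, $\Gamma=\partial I\times(-\tfrac12,\tfrac12)$. For $X\in\{W,R\}$ let $Q_X^2$ be a quadratic form on $\mathbb R^{2\times2}$ that depends only on the symmetric part of its argument and is positive definite on symmetric matrices; write $Q_X^2(q_{11},q_{12},q_{22})$ for its value at the symmetric matrix with these entries, and set $$Q_X^1(q_{11},q_{12})=\min_{\alpha\in\mathbb R}Q_X^2(q_{11},q_{12},\alpha),\qquad Q_X^0(q_{11})=\min_{z\in\mathbb R}Q_X^1(q_{11},z).$$ For $\hat u_1\in W^{1,2}(I)$ and $\hat u_2,\hat v\in W^{2,2}(I)$ let $BN_{(\hat u_1,\hat u_2)}(S;\mathbb R^2)$ be the set of $y\in W^{1,2}(S;\mathbb R^2)$ with $e(y)_{12}=e(y)_{22}=0$, where $e(y)=\frac12(\nabla y+\nabla y^T)$, and with $y_1=\hat u_1-x_2\hat u_2'$, $y_2=\hat u_2$ on $\Gamma$ in the sense of traces. Let $W^{2,2}_{\hat v}(I)$ be the set of $w\in W^{2,2}(I)$ with $w=\hat v$, $w'=\hat v'$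 on $\partial I$, and put $$\mathscr S^{1D}=BN_{(\hat u_1,\hat u_2)}(S;\mathbb R^2)\times W^{2,2}_{\hat v}(I)\times W^{1,2}_0(I),$$ with $\|(y,w,\theta)\|_{can}=\|y\|_{W^{1,2}(S;\mathbb R^2)}+\|w\|_{W^{2,2}(I)}+\|\theta\|_{W^{1,2}(I)}$. Functions on $I$ are regarded as functions on $S$ that do not depend on $x_2$. For $u=(y,w,\theta)$ and $\tilde u=(\tilde y,\tilde w,\tilde\theta)$ in $\mathscr S^{1D}$ define the (force-free) energy and the dissipation distance $$\phi_0(u)=\frac12\int_S Q_W^0\Big(\partial_1y_1+\frac{|w'|^2}2\Big)+\frac1{24}\int_I Q_W^1(w'',\theta'),$$ $$\mathcal D_0(u,\tilde u)=\Big(\int_S Q_R^0\Big(\partial_1y_1-\partial_1\tilde y_1+\frac{|w'|^2}2-\frac{|\tilde w'|^2}2\Big)+\frac1{12}\int_I Q_R^1(w''-\tilde w'',\theta'-\tilde\theta')\Big)^{1/2}.$$ For $C,M>0$ let $\Phi^1(t)=\sqrt{t^2+Ct^3+Ct^4}$ and $\Phi^2_M(t)=C\sqrt M\,t^2+Ct^3+Ct^4$.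 Write $h^+=\max(h,0)$. The local slope is $$|\partial\phi_0|_{\mathcal D_0}(u)=\limsup_{\mathcal D_0(u,\tilde u)\to0,\ \tilde u\ne u}\frac{(\phi_0(u)-\phi_0(\tilde u))^+}{\mathcal D_0(u,\tilde u)}\in[0,\infty].$$ There is a constant $C_0>0$ depending only on $l$, $Q_W^2$, $Q_R^2$ such that, for all $\hat u_1\in W^{1,2}(I)$ and $\hat u_2,\hat v\in W^{2,2}(I)$, the following holds. (i) For all $C\ge C_0$, all $M>0$ and all $u\in\mathscr S^{1D}$ with $\phi_0(u)\le M$, $$|\partial\phi_0|_{\mathcal D_0}(u)=\sup_{\tilde u\in\mathscr S^{1D},\ \tilde u\neq u}\frac{\big(\phi_0(u)-\phi_0(\tilde u)-\Phi^2_M(\mathcal D_0(u,\tilde u))\big)^+}{\Phi^1(\mathcal D_0(u,\tilde u))}.$$ (ii) $|\partial\phi_0|_{\mathcal D_0}$ is a strong upper gradient for $\phi_0$: for every open interval $J\subset\mathbb R$ and every curve $z\colon J\to\mathscr S^{1D}$ that is absolutely continuous with respect to $\mathcal D_0$ (that is, for some $m\in L^1(J)$, $\mathcal D_0(z(s),z(t))\le\int_s^t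 m(r)\,dr$ for all $s\le t$ in $J$), the function $|\partial\phi_0|_{\mathcal D_0}\circ z$ is Borel and $$|\phi_0(z(t))-\phi_0(z(s))|\le\int_s^t|\partial\phi_0|_{\mathcal D_0}(z(r))\,|z'|_{\mathcal D_0}(r)\,dr\qquad\text{for all }s\le t\text{ in }J,$$ where $|z'|_{\mathcal D_0}(r)=\lim_{s\to r}\mathcal D_0(z(s),z(r))/|s-r|$ (which exists for a.e. $r$) is the metric derivative. (iii) If a sequence $(u_k)_k\subset\mathscr S^{1D}$ converges weakly with respect to $\|\cdot\|_{can}$ to $u\in\mathscr S^{1D}$, then $\liminf_{k\to\infty}|\partial\phi_0|_{\mathcal D_0}(u_k)\ge|\partial\phi_0|_{\mathcal D_0}(u)$. -/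

import Mathlib

open MeasureTheory Filter Topology Set
open scoped ContDiff ENNReal

noncomputable section

namespace VKRibbon

/-! ### Weak derivatives, traces and Sobolev spaces -/

/-- `v` is the weak derivative of `u` on the open set `Ω` in the direction `e`:
`∫_Ω u ∂ₑφ = - ∫_Ω v φ` for every `φ ∈ C_c^∞(Ω)`. -/
def HasWeakDeriv {V : Type*} [NormedAddCommGroup V] [NormedSpace ℝ V] [MeasureSpace V]
    (Ω : Set V) (e : V) (u v : V → ℝ) : Prop :=
  ∀ φ : V → ℝ, ContDiff ℝ ∞ φ → HasCompactSupport φ → tsupport φ ⊆ Ω →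
    ∫ x in Ω, u x * fderiv ℝ φ x e = -∫ x in Ω, v x * φ x

/-- Vanishing trace, expressed through Green's formula.  If `u` is a Sobolev function on the
Lipschitz domain `Ω` and `v = ∂ₑ u`, then `∫_Ω (u ∂ₑφ + v φ) = ∫_{∂Ω} (tr u) φ (e · ν)` for all
`φ ∈ C_c^∞(V)`, `ν` the outer unit normal; the predicate says that this vanishes for all `φ`,
i.e. that `tr u = 0` almost everywhere on the part of `∂Ω` where `e · ν ≠ 0`.
For `Ω` an interval and `e = 1` this part consists of the two end points; for a rectangle
with sides parallel to the axes and `e = (1, 0)` it consists of the two vertical sides. -/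
def HasZeroTrace {V : Type*} [NormedAddCommGroup V] [NormedSpace ℝ V] [MeasureSpace V]
    (Ω : Set V) (e : V) (u v : V → ℝ) : Prop :=
  ∀ φ : V → ℝ, ContDiff ℝ ∞ φ → HasCompactSupport φ →
    ∫ x in Ω, (u x * fderiv ℝ φ x e + v x * φ x) = 0

section Linear

set_option linter.unusedSectionVars false

variable {V : Type*} [NormedAddCommGroup V] [NormedSpace ℝ V] [MeasureSpace V] [BorelSpace V]
  [IsFiniteMeasureOnCompacts (volume : Measure V)] {Ω : Set V} {e : V}

theorem integrable_mul_test (u : Lp ℝ 2 (volume.restrict Ω)) {φ : V → ℝ} (hφ : Continuous φ)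
    (hc : HasCompactSupport φ) : Integrable (fun x => u x * φ x) (volume.restrict Ω) :=
  (Lp.memLp u).integrable_mul (q := 2) ((hφ.memLp_of_hasCompactSupport hc).restrict Ω)

theorem continuous_dirDeriv {φ : V → ℝ} (hφ : ContDiff ℝ ∞ φ) :
    Continuous (fun x => fderiv ℝ φ x e) :=
  (hφ.continuous_fderiv (by simp)).clm_apply continuous_const

theorem hasCompactSupport_dirDeriv {φ : V → ℝ} (hc : HasCompactSupport φ) :
    HasCompactSupport (fun x => fderiv ℝ φ x e) :=
  hc.fderiv_apply (𝕜 := ℝ) e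

theorem integral_add_mul (u u' : Lp ℝ 2 (volume.restrict Ω)) {φ : V → ℝ} (hφ : Continuous φ)
    (hc : HasCompactSupport φ) :
    ∫ x in Ω, (u + u' : Lp ℝ 2 (volume.restrict Ω)) x * φ x
      = (∫ x in Ω, u x * φ x) + ∫ x in Ω, u' x * φ x := by
  rw [← integral_add (integrable_mul_test u hφ hc) (integrable_mul_test u' hφ hc)]
  refine integral_congr_ae ?_
  filter_upwards [Lp.coeFn_add u u'] with x hx
  rw [hx, Pi.add_apply, add_mul]

theorem integral_smul_mul (c : ℝ) (u : Lp ℝ 2 (volume.restrict Ω)) (φ : V → ℝ) :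
    ∫ x in Ω, (c • u : Lp ℝ 2 (volume.restrict Ω)) x * φ x = c * ∫ x in Ω, u x * φ x := by
  rw [← integral_const_mul]
  refine integral_congr_ae ?_
  filter_upwards [Lp.coeFn_smul c u] with x hx
  rw [hx, Pi.smul_apply, smul_eq_mul, mul_assoc]

theorem HasWeakDeriv.add {u v u' v' : Lp ℝ 2 (volume.restrict Ω)} (h : HasWeakDeriv Ω e u v)
    (h' : HasWeakDeriv Ω e u' v') :
    HasWeakDeriv Ω e (u + u' : Lp ℝ 2 (volume.restrict Ω))
      (v + v' : Lp ℝ 2 (volume.restrict Ω)) := by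
  intro φ hφ hc hs
  rw [integral_add_mul u u' (continuous_dirDeriv hφ) (hasCompactSupport_dirDeriv hc),
    integral_add_mul v v' hφ.continuous hc, h φ hφ hc hs, h' φ hφ hc hs]
  ring

theorem HasWeakDeriv.smul {u v : Lp ℝ 2 (volume.restrict Ω)} (c : ℝ)
    (h : HasWeakDeriv Ω e u v) :
    HasWeakDeriv Ω e (c • u : Lp ℝ 2 (volume.restrict Ω))
      (c • v : Lp ℝ 2 (volume.restrict Ω)) := by
  intro φ hφ hc hs
  rw [integral_smul_mul, integral_smul_mul, h φ hφ hc hs]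
  ring

theorem HasWeakDeriv.zero :
    HasWeakDeriv Ω e (0 : Lp ℝ 2 (volume.restrict Ω)) (0 : Lp ℝ 2 (volume.restrict Ω)) := by
  intro φ hφ hc hs
  have h0 : ∀ ψ : V → ℝ, ∫ x in Ω, (0 : Lp ℝ 2 (volume.restrict Ω)) x * ψ x = 0 := by
    intro ψ
    rw [← zero_smul ℝ (0 : Lp ℝ 2 (volume.restrict Ω)), integral_smul_mul, zero_mul]
  rw [h0, h0, neg_zero]

end Linear

/-- The interval `I = (-l/2, l/2)`. -/
def I (l : ℝ) : Set ℝ := Ioo (-(l / 2)) (l / 2)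

/-- The rectangle `S = I × (-1/2, 1/2)`. -/
def S (l : ℝ) : Set (ℝ × ℝ) := I l ×ˢ Ioo (-(1 / 2)) (1 / 2)

/-- `L²(I)`. -/
abbrev L2I (l : ℝ) := Lp ℝ 2 (volume.restrict (I l))

/-- `L²(S)`. -/
abbrev L2S (l : ℝ) := Lp ℝ 2 (volume.restrict (S l))

/-- `W^{k,2}(I)`: a function together with its weak derivatives (`u j` is the derivative of
order `j`), all in `L²(I)`, with the norm `(∑_{j ≤ k} ‖u j‖²_{L²})^{1/2}`. -/
def SobolevI (l : ℝ) (k : ℕ) : Submodule ℝ (PiLp 2 (fun _ : Fin (k + 1) => L2I l)) where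
  carrier := {u | ∀ j : Fin k, HasWeakDeriv (I l) 1 (u j.castSucc) (u j.succ)}
  add_mem' hu hv j := (hu j).add (hv j)
  zero_mem' _ := HasWeakDeriv.zero
  smul_mem' c _ hu j := (hu j).smul c

/-- `W^{1,2}(S; ℝ²)`: for the component `i`, the entry `(i, 0)` is `yᵢ`, and the entries
`(i, 1)`, `(i, 2)` are its weak partial derivatives `∂₁ yᵢ`, `∂₂ yᵢ`; the norm is the square root
of the sum of the squared `L²` norms of all entries. -/
def SobolevS (l : ℝ) : Submodule ℝ (PiLp 2 (fun _ : Fin 2 × Fin 3 => L2S l)) where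
  carrier := {y | ∀ i : Fin 2, HasWeakDeriv (S l) (1, 0) (y (i, 0)) (y (i, 1)) ∧
    HasWeakDeriv (S l) (0, 1) (y (i, 0)) (y (i, 2))}
  add_mem' hu hv i := ⟨(hu i).1.add (hv i).1, (hu i).2.add (hv i).2⟩
  zero_mem' _ := ⟨HasWeakDeriv.zero, HasWeakDeriv.zero⟩
  smul_mem' c _ hu i := ⟨(hu i).1.smul c, (hu i).2.smul c⟩

/-- `u ∈ W^{k,2}_{uhat}(I)`: the traces of `u` and `uhat` at the end points of `I` agree up to the
order `k - 1`. -/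
def HasBoundaryValues {l : ℝ} {k : ℕ} (u uhat : SobolevI l k) : Prop :=
  ∀ j : Fin k, HasZeroTrace (I l) 1
    (fun x => u.1 j.castSucc x - uhat.1 j.castSucc x) (fun x => u.1 j.succ x - uhat.1 j.succ x)

/-- The Bernoulli-Navier functions with boundary data `(uhat₁, uhat₂)`: `y ∈ W^{1,2}(S; ℝ²)` with
`e(y)₁₂ = e(y)₂₂ = 0` and, in the sense of traces, `y₁ = uhat₁ - x₂ uhat₂'` and `y₂ = uhat₂` on
`Γ = ∂I × (-1/2, 1/2)`. -/
def IsBernoulliNavier {l : ℝ} (uhat₁ : SobolevI l 1) (uhat₂ : SobolevI l 2) (y : SobolevS l) : Prop :=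
  (∀ᵐ x ∂volume.restrict (S l), (y.1 (0, 2) x + y.1 (1, 1) x) / 2 = 0) ∧
  (∀ᵐ x ∂volume.restrict (S l), y.1 (1, 2) x = 0) ∧
  HasZeroTrace (S l) (1, 0)
    (fun x => y.1 (0, 0) x - (uhat₁.1 0 x.1 - x.2 * uhat₂.1 1 x.1))
    (fun x => y.1 (0, 1) x - (uhat₁.1 1 x.1 - x.2 * uhat₂.1 2 x.1)) ∧
  HasZeroTrace (S l) (1, 0)
    (fun x => y.1 (1, 0) x - uhat₂.1 0 x.1)
    (fun x => y.1 (1, 1) x - uhat₂.1 1 x.1)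

/-- `W^{1,2}(S; ℝ²) × W^{2,2}(I) × W^{1,2}(I)` with the canonical norm
`‖y‖ + ‖w‖ + ‖θ‖`. -/
abbrev Ambient (l : ℝ) :=
  WithLp 1 (SobolevS l × WithLp 1 (SobolevI l 2 × SobolevI l 1))

namespace Ambient

variable {l : ℝ}

/-- The in-plane displacement `y`. -/
abbrev y (u : Ambient l) : SobolevS l := u.fst

/-- The out-of-plane displacement `w`. -/
abbrev w (u : Ambient l) : SobolevI l 2 := u.snd.fst

/-- The twist `θ`. -/
abbrev θ (u : Ambient l) : SobolevI l 1 := u.snd.snd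

end Ambient

/-- The admissible states `BN_{(uhat₁, uhat₂)}(S; ℝ²) × W^{2,2}_{vhat}(I) × W^{1,2}_0(I)`. -/
def S1D {l : ℝ} (uhat₁ : SobolevI l 1) (uhat₂ vhat : SobolevI l 2) : Set (Ambient l) :=
  {u | IsBernoulliNavier uhat₁ uhat₂ u.y ∧ HasBoundaryValues u.w vhat ∧ HasBoundaryValues u.θ 0}

/-! ### Quadratic forms, energy and dissipation distance -/

/-- A quadratic form on `ℝ^{2×2}` that depends only on the symmetric part of its argument and is
positive definite on symmetric matrices. -/
structure IsAdmissibleForm (Q : QuadraticForm ℝ (Matrix (Fin 2) (Fin 2) ℝ)) : Prop where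
  symmPart : ∀ A, Q A = Q ((1 / 2 : ℝ) • (A + A.transpose))
  pos : ∀ A : Matrix (Fin 2) (Fin 2) ℝ, A.IsSymm → A ≠ 0 → 0 < Q A

/-- `Q¹(q₁₁, q₁₂) = min_α Q²(q₁₁, q₁₂, α)`. -/
def Q1 (Q : QuadraticForm ℝ (Matrix (Fin 2) (Fin 2) ℝ)) (q₁₁ q₁₂ : ℝ) : ℝ :=
  ⨅ α : ℝ, Q !![q₁₁, q₁₂; q₁₂, α]

/-- `Q⁰(q₁₁) = min_z Q¹(q₁₁, z)`. -/
def Q0 (Q : QuadraticForm ℝ (Matrix (Fin 2) (Fin 2) ℝ)) (q₁₁ : ℝ) : ℝ :=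
  ⨅ z : ℝ, Q1 Q q₁₁ z

/-- The (force-free) energy
`φ₀(y, w, θ) = ½ ∫_S Q_W⁰(∂₁y₁ + |w'|²/2) + (1/24) ∫_I Q_W¹(w'', θ')`. -/
def energy {l : ℝ} (QW : QuadraticForm ℝ (Matrix (Fin 2) (Fin 2) ℝ)) (u : Ambient l) : ℝ :=
  1 / 2 * (∫ x in S l, Q0 QW (u.y.1 (0, 1) x + (u.w.1 1 x.1) ^ 2 / 2))
    + 1 / 24 * (∫ t in I l, Q1 QW (u.w.1 2 t) (u.θ.1 1 t))

/-- The dissipation distance `𝒟₀`, the square root of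
`∫_S Q_R⁰(∂₁y₁ - ∂₁ỹ₁ + |w'|²/2 - |w̃'|²/2) + (1/12) ∫_I Q_R¹(w'' - w̃'', θ' - θ̃')`. -/
def dissip {l : ℝ} (QR : QuadraticForm ℝ (Matrix (Fin 2) (Fin 2) ℝ)) (u v : Ambient l) : ℝ :=
  √((∫ x in S l, Q0 QR (u.y.1 (0, 1) x - v.y.1 (0, 1) x
        + (u.w.1 1 x.1) ^ 2 / 2 - (v.w.1 1 x.1) ^ 2 / 2))
    + 1 / 12 * (∫ t in I l, Q1 QR (u.w.1 2 t - v.w.1 2 t) (u.θ.1 1 t - v.θ.1 1 t)))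

/-! ### Slopes and upper gradients -/

section Metric

variable {X : Type*} (D : X → X → ℝ)

/-- The local slope `limsup_{z → u} (φ(u) - φ(z))⁺ / D(u, z)`, the limit being taken over
`z ≠ u` with `D(u, z) → 0`. -/
def localSlope (φ : X → ℝ) (u : X) : ℝ≥0∞ :=
  limsup (fun z => ENNReal.ofReal (max (φ u - φ z) 0 / D u z))
    (comap (D u) (𝓝 0) ⊓ 𝓟 {u}ᶜ)

/-- Absolutely continuous curves on an open interval `J` (only the values on `J` matter). -/
def IsACCurve (J : Set ℝ) (γ : ℝ → X) : Prop :=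
  ∃ m : ℝ → ℝ, IntegrableOn m J ∧
    ∀ s ∈ J, ∀ t ∈ J, s ≤ t → D (γ s) (γ t) ≤ ∫ r in s..t, m r

/-- The metric derivative `|γ'|(t) = lim_{s → t} D(γ(s), γ(t)) / |s - t|`; for an absolutely
continuous curve the limit exists at almost every `t`, and where it exists it is the `limsup`. -/
def metricDeriv (γ : ℝ → X) (t : ℝ) : ℝ≥0∞ :=
  limsup (fun s => ENNReal.ofReal (D (γ s) (γ t) / |s - t|)) (𝓝[≠] t)

/-- `g` is a strong upper gradient for `φ`: for every absolutely continuous curve `γ` on an open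
(bounded or unbounded) interval `J`, `g ∘ γ` is Borel and
`|φ(γ(t)) - φ(γ(s))| ≤ ∫_s^t g(γ(r)) |γ'|(r) dr` for all `s ≤ t` in `J`. -/
def IsStrongUpperGradient (φ : X → ℝ) (g : X → ℝ≥0∞) : Prop :=
  ∀ (J : Set ℝ) (γ : ℝ → X), IsOpen J → J.OrdConnected → IsACCurve D J γ →
    Measurable (fun t : J => g (γ t)) ∧
    ∀ s ∈ J, ∀ t ∈ J, s ≤ t →
      ENNReal.ofReal |φ (γ t) - φ (γ s)| ≤ ∫⁻ r in Ioo s t, g (γ r) * metricDeriv D γ r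

end Metric

/-- `Φ¹(t) = √(t² + C t³ + C t⁴)`. -/
def Φ₁ (C t : ℝ) : ℝ := √(t ^ 2 + C * t ^ 3 + C * t ^ 4)

/-- `Φ²_M(t) = C √M t² + C t³ + C t⁴`. -/
def Φ₂ (C M t : ℝ) : ℝ := C * √M * t ^ 2 + C * t ^ 3 + C * t ^ 4

/-- The local slope `|∂φ₀|_{𝒟₀}` in the space `S1D` with distance `𝒟₀`. -/
def slope1D {l : ℝ} (QW QR : QuadraticForm ℝ (Matrix (Fin 2) (Fin 2) ℝ))
    (uhat₁ : SobolevI l 1) (uhat₂ vhat : SobolevI l 2) : S1D uhat₁ uhat₂ vhat → ℝ≥0∞ :=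
  localSlope (fun u v : S1D uhat₁ uhat₂ vhat => dissip QR u.1 v.1) (fun u => energy QW u.1)

end VKRibbon

end

open VKRibbon

noncomputable section

namespace VKRibbon

/-! ### Slopes of quadratic energies along almost convex paths -/

/-! Completing squares gives `Q⁰(p) = c p²` and `Q¹(p, q) = g (q + k p)² + c p²` with `c, g > 0`.
Hence, in terms of the strain `(∂₁y₁ + |w'|²/2, w'', θ')` in a product of `L²` spaces, the energy is
`½‖A strain‖²` and the distance is `‖B (strain u - strain v)‖`, with `A`, `B` bounded linear and `B`
bounded below. The only nonlinearity is `|w'|²/2`.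

The admissible set is affine, and along the segment from `u` to `v` the strain differs from its
affine interpolation by `s(1-s)` times `½|w' - w̃'|²`. Since `w' - w̃'` vanishes at the end points
of `I`, it is bounded by `√l ‖w'' - w̃''‖`, so this defect is quadratic in the distance
(`exists_isAlmostConvex`). The constant involves only `l` and the two forms.

For (i), moving by a small fraction `s` towards `v` gains at least `s (φ(u) - φ(v) - Φ²)` in energy
at distance at most `s Φ¹` (`exists_descent`), so the slope dominates every quotient. Conversely,
`Φ¹(t)/t → 1` and `Φ²(t)/t → 0` as `t → 0`.

For (ii), the energy is absolutely continuous along the curve, and at almost every time the modulus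
of its derivative is at most slope times metric derivative. Borel measurability follows from lower
semicontinuity.

For (iii), the supremum in (i) is tested with `z_k + (v - u)`. The strains of `z_k` converge only
weakly, but the differences of strains converge strongly, because `w_k' → w'` strongly in `L²`. So
differences of energies converge although the energies need not. -/

theorem Φ₁_eq {C t : ℝ} (ht : 0 ≤ t) : Φ₁ C t = t * √(1 + C * t + C * t ^ 2) := by
  have : t ^ 2 + C * t ^ 3 + C * t ^ 4 = t ^ 2 * (1 + C * t + C * t ^ 2) := by ring
  rw [Φ₁, this, Real.sqrt_mul (sq_nonneg t), Real.sqrt_sq ht]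

theorem Φ₁_pos {C t : ℝ} (hC : 0 ≤ C) (ht : 0 < t) : 0 < Φ₁ C t := by
  unfold Φ₁; positivity

/-- An energy `½‖a u‖²` and a distance `‖b u - b v‖` together with paths along which `a` and `b`
are affine up to an error of the order of the squared distance of the end points. -/
structure IsAlmostConvex {X H : Type*} [NormedAddCommGroup H] [InnerProductSpace ℝ H]
    (a b : X → H) (K : ℝ) : Prop where
  one_le : 1 ≤ K
  norm_sub_le : ∀ u v, ‖a u - a v‖ ≤ K * ‖b u - b v‖
  exists_path : ∀ u v, ∃ p q : H, ‖p‖ ≤ K * ‖b u - b v‖ ^ 2 ∧ ‖q‖ ≤ K * ‖b u - b v‖ ^ 2 ∧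
    ∀ s ∈ Ioo (0 : ℝ) 1, ∃ z, a z = a u + s • (a v - a u) - (s * (1 - s)) • p ∧
      b z = b u + s • (b v - b u) - (s * (1 - s)) • q

section Abstract

variable {X H : Type*} [NormedAddCommGroup H] [InnerProductSpace ℝ H] {a b : X → H} {K : ℝ}

/-- In this form a difference of energies is linear in `x` once `x - y` is given, so it passes to
the limit when `x` converges weakly and `x - y` strongly. -/
theorem half_norm_sq_sub (x y : H) :
    1 / 2 * ‖x‖ ^ 2 - 1 / 2 * ‖y‖ ^ 2 = inner ℝ (x - y) x - 1 / 2 * ‖x - y‖ ^ 2 := by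
  rw [norm_sub_sq_real, inner_sub_left, real_inner_self_eq_norm_sq, real_inner_comm]
  ring

/-- Convexity of the squared norm enters through `s² ≤ s`; the terms containing `p` are treated by
Cauchy-Schwarz and keep a factor `s`. -/
theorem half_norm_sq_path_le (x δ p : H) {s : ℝ} (h0 : 0 ≤ s) (h1 : s ≤ 1) :
    1 / 2 * ‖x + s • δ - (s * (1 - s)) • p‖ ^ 2 ≤ 1 / 2 * ‖x‖ ^ 2
      + s * (1 / 2 * ‖x + δ‖ ^ 2 - 1 / 2 * ‖x‖ ^ 2 + ‖x‖ * ‖p‖ + ‖δ‖ * ‖p‖ + 1 / 2 * ‖p‖ ^ 2) := by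
  have e1 : 1 / 2 * ‖x + s • δ - (s * (1 - s)) • p‖ ^ 2 = 1 / 2 * ‖x‖ ^ 2 + s * inner ℝ x δ
      + 1 / 2 * s ^ 2 * ‖δ‖ ^ 2 - s * (1 - s) * inner ℝ x p - s ^ 2 * (1 - s) * inner ℝ δ p
      + 1 / 2 * s ^ 2 * (1 - s) ^ 2 * ‖p‖ ^ 2 := by
    rw [norm_sub_sq_real, norm_add_sq_real, inner_add_left, norm_smul, norm_smul, mul_pow, mul_pow,
      Real.norm_eq_abs, Real.norm_eq_abs, sq_abs, sq_abs]
    simp only [inner_smul_left, inner_smul_right, RCLike.conj_to_real]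
    ring
  have e2 : ‖x + δ‖ ^ 2 = ‖x‖ ^ 2 + 2 * inner ℝ x δ + ‖δ‖ ^ 2 := norm_add_sq_real x δ
  have i1 : -inner ℝ x p ≤ ‖x‖ * ‖p‖ := (neg_le_abs _).trans (abs_real_inner_le_norm x p)
  have i2 : -inner ℝ δ p ≤ ‖δ‖ * ‖p‖ := (neg_le_abs _).trans (abs_real_inner_le_norm δ p)
  have hs : 0 ≤ 1 - s := by linarith
  have hxp : 0 ≤ ‖x‖ * ‖p‖ := by positivity
  have hdp : 0 ≤ ‖δ‖ * ‖p‖ := by positivity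
  have j1 : s * (1 - s) * -inner ℝ x p ≤ s * (‖x‖ * ‖p‖) := by
    calc _ ≤ s * (1 - s) * (‖x‖ * ‖p‖) := by gcongr
      _ ≤ s * 1 * (‖x‖ * ‖p‖) := by gcongr; linarith
      _ = _ := by ring
  have j2 : s * (s * (1 - s)) * -inner ℝ δ p ≤ s * (‖δ‖ * ‖p‖) := by
    calc _ ≤ s * (s * (1 - s)) * (‖δ‖ * ‖p‖) := by gcongr
      _ ≤ s * (1 * 1) * (‖δ‖ * ‖p‖) := by gcongr; linarith
      _ = _ := by ring
  have j3 : s * (s * (1 - s) ^ 2) * (1 / 2 * ‖p‖ ^ 2) ≤ s * (1 * 1 ^ 2) * (1 / 2 * ‖p‖ ^ 2) := by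
    gcongr; linarith
  have j4 : s * s * (1 / 2 * ‖δ‖ ^ 2) ≤ s * 1 * (1 / 2 * ‖δ‖ ^ 2) := by gcongr
  rw [e1, e2]
  linarith

namespace IsAlmostConvex

theorem nonneg (h : IsAlmostConvex a b K) : 0 ≤ K := zero_le_one.trans h.one_le

/-- The competitor is the point at parameter `s` on the path to `v`. As `K ≥ 1`, the bound `2K² ≤ C`
absorbs the constants `2K`, `K²` and `½K²` that occur. -/
theorem exists_descent (h : IsAlmostConvex a b K) {C M : ℝ} (hC : 2 * K ^ 2 ≤ C)
    {u : X} (hM : 1 / 2 * ‖a u‖ ^ 2 ≤ M) (v : X) {s : ℝ} (hs : s ∈ Ioo (0 : ℝ) 1) :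
    ∃ z, s * (1 / 2 * ‖a u‖ ^ 2 - 1 / 2 * ‖a v‖ ^ 2 - Φ₂ C M ‖b u - b v‖)
        ≤ 1 / 2 * ‖a u‖ ^ 2 - 1 / 2 * ‖a z‖ ^ 2 ∧
      ‖b u - b z‖ ≤ s * Φ₁ C ‖b u - b v‖ := by
  obtain ⟨p, q, hp, hq, hz⟩ := h.exists_path u v
  obtain ⟨z, hza, hzb⟩ := hz s hs
  have hK := h.one_le
  have hK0 := h.nonneg
  have hKK : K ≤ K ^ 2 := by nlinarith
  set D := ‖b u - b v‖ with hD
  have hD0 : 0 ≤ D := norm_nonneg _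
  have hC0 : 0 ≤ C := by nlinarith
  refine ⟨z, ?_, ?_⟩
  · have key := half_norm_sq_path_le (a u) (a v - a u) p hs.1.le hs.2.le
    rw [← hza, add_sub_cancel] at key
    have hδ : ‖a v - a u‖ ≤ K * D := by rw [norm_sub_rev]; exact h.norm_sub_le u v
    have hau : ‖a u‖ ≤ 2 * √M := by
      have hM0 : 0 ≤ M := le_trans (by positivity) hM
      apply abs_le_of_sq_le_sq' _ (by positivity) |>.2
      rw [mul_pow, Real.sq_sqrt hM0]; linarith
    have b1 : ‖a u‖ * ‖p‖ ≤ C * √M * D ^ 2 := by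
      calc _ ≤ (2 * √M) * (K * D ^ 2) := by gcongr
        _ = (2 * K) * (√M * D ^ 2) := by ring
        _ ≤ C * (√M * D ^ 2) := by gcongr; linarith
        _ = _ := by ring
    have b2 : ‖a v - a u‖ * ‖p‖ ≤ C * D ^ 3 := by
      calc _ ≤ (K * D) * (K * D ^ 2) := by gcongr
        _ = K ^ 2 * D ^ 3 := by ring
        _ ≤ C * D ^ 3 := by gcongr; nlinarith
    have b3 : 1 / 2 * ‖p‖ ^ 2 ≤ C * D ^ 4 := by
      calc _ ≤ 1 / 2 * (K * D ^ 2) ^ 2 := by gcongr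
        _ = (1 / 2 * K ^ 2) * D ^ 4 := by ring
        _ ≤ C * D ^ 4 := by gcongr; nlinarith
    have := mul_le_mul_of_nonneg_left (add_le_add (add_le_add b1 b2) b3) hs.1.le
    unfold Φ₂
    linarith
  · have e : b u - b z = s • ((b u - b v) + (1 - s) • q) := by
      rw [hzb, mul_smul]; module
    rw [e, norm_smul, Real.norm_eq_abs, abs_of_pos hs.1]
    refine mul_le_mul_of_nonneg_left ?_ hs.1.le
    have hn : ‖(b u - b v) + (1 - s) • q‖ ≤ D + K * D ^ 2 := by
      refine (norm_add_le _ _).trans ?_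
      rw [norm_smul, Real.norm_eq_abs, abs_of_pos (by linarith [hs.2] : 0 < 1 - s)]
      have : (1 - s) * ‖q‖ ≤ 1 * (K * D ^ 2) := by
        gcongr
        linarith [hs.1]
      linarith
    -- The square of `D + K D²` is `D² + 2K D³ + K² D⁴`, which explains the form of `Φ¹`.
    refine hn.trans (Real.le_sqrt_of_sq_le ?_)
    have t1 : 2 * K * D ^ 3 ≤ C * D ^ 3 := by gcongr; linarith
    have t2 : K ^ 2 * D ^ 4 ≤ C * D ^ 4 := by gcongr; nlinarith
    nlinarith

/-- The representation of the local slope as a supremum over all competitors. -/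
theorem localSlope_eq (h : IsAlmostConvex a b K) {C M : ℝ} (hC : 2 * K ^ 2 ≤ C)
    {u : X} (hM : 1 / 2 * ‖a u‖ ^ 2 ≤ M) :
    localSlope (fun u v => ‖b u - b v‖) (fun u => 1 / 2 * ‖a u‖ ^ 2) u =
      ⨆ (v : X) (_ : u ≠ v), ENNReal.ofReal
        (max (1 / 2 * ‖a u‖ ^ 2 - 1 / 2 * ‖a v‖ ^ 2 - Φ₂ C M ‖b u - b v‖) 0
          / Φ₁ C ‖b u - b v‖) := by
  have hC0 : 0 ≤ C := by nlinarith [h.one_le]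
  have hau : ∀ z, ‖b u - b z‖ = 0 → a u = a z := fun z hz => by
    have := h.norm_sub_le u z
    rw [hz, mul_zero] at this
    exact sub_eq_zero.1 (norm_le_zero_iff.1 this)
  apply le_antisymm
  · set G := ⨆ (v : X) (_ : u ≠ v), ENNReal.ofReal
        (max (1 / 2 * ‖a u‖ ^ 2 - 1 / 2 * ‖a v‖ ^ 2 - Φ₂ C M ‖b u - b v‖) 0
          / Φ₁ C ‖b u - b v‖) with hG
    by_cases hGt : G = ⊤
    · rw [hGt]; exact le_top
    -- `N / t` is at most `(N - Φ²)⁺ / Φ¹` times `Φ¹ / t`, plus `Φ² / t`. The resulting bound `g` is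
    -- continuous at `0` with value `G`, which uses `G ≠ ⊤`.
    set g : ℝ → ℝ≥0∞ := fun t => G * ENNReal.ofReal (√(1 + C * t + C * t ^ 2))
      + ENNReal.ofReal (C * √M * t + C * t ^ 2 + C * t ^ 3) with hg
    have hle : ∀ᶠ z in comap (fun z => ‖b u - b z‖) (𝓝 0) ⊓ 𝓟 {u}ᶜ,
        ENNReal.ofReal (max (1 / 2 * ‖a u‖ ^ 2 - 1 / 2 * ‖a z‖ ^ 2) 0 / ‖b u - b z‖)
          ≤ g ‖b u - b z‖ := by
      filter_upwards [mem_inf_of_right (mem_principal_self _)] with z hz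
      have hzu : u ≠ z := fun e => hz e.symm
      -- At distance zero the quotient is `0` by the convention for division by zero.
      rcases (norm_nonneg (b u - b z)).eq_or_lt' with h0 | h0
      · rw [h0, div_zero, ENNReal.ofReal_zero]; exact zero_le
      set t := ‖b u - b z‖ with ht
      have hR : ENNReal.ofReal (max (1 / 2 * ‖a u‖ ^ 2 - 1 / 2 * ‖a z‖ ^ 2 - Φ₂ C M t) 0
          / Φ₁ C t) ≤ G := le_iSup₂ (f := fun (v : X) (_ : u ≠ v) => ENNReal.ofReal
        (max (1 / 2 * ‖a u‖ ^ 2 - 1 / 2 * ‖a v‖ ^ 2 - Φ₂ C M ‖b u - b v‖) 0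
          / Φ₁ C ‖b u - b v‖)) z hzu
      set N := 1 / 2 * ‖a u‖ ^ 2 - 1 / 2 * ‖a z‖ ^ 2
      have hΦ2 : Φ₂ C M t = t * (C * √M * t + C * t ^ 2 + C * t ^ 3) := by unfold Φ₂; ring
      have hΦ1 := Φ₁_eq (C := C) h0.le
      have hpos := Φ₁_pos hC0 h0
      have hr : 0 ≤ C * √M * t + C * t ^ 2 + C * t ^ 3 := by positivity
      have hreal : max N 0 / t ≤ max (N - Φ₂ C M t) 0 / Φ₁ C t * √(1 + C * t + C * t ^ 2)
          + (C * √M * t + C * t ^ 2 + C * t ^ 3) := by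
        have hsq : 0 < √(1 + C * t + C * t ^ 2) := Real.sqrt_pos.2 (by positivity)
        have : max (N - Φ₂ C M t) 0 / Φ₁ C t * √(1 + C * t + C * t ^ 2)
            = max (N - Φ₂ C M t) 0 / t := by
          rw [hΦ1]; field_simp
        rw [this, div_le_iff₀ h0, add_mul, div_mul_cancel₀ _ h0.ne']
        rw [max_le_iff]
        constructor
        · have := le_max_left (N - Φ₂ C M t) 0
          linarith
        · have := le_max_right (N - Φ₂ C M t) 0
          positivity
      calc _ ≤ _ := ENNReal.ofReal_le_ofReal hreal
        _ ≤ _ := ENNReal.ofReal_add_le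
        _ ≤ g t := by
          rw [ENNReal.ofReal_mul (by positivity)]
          exact add_le_add (mul_le_mul_left hR _) le_rfl
    have hgc : Tendsto g (𝓝 0) (𝓝 G) := by
      have h1 : Tendsto (fun t : ℝ => ENNReal.ofReal (√(1 + C * t + C * t ^ 2))) (𝓝 0) (𝓝 1) := by
        have : Continuous fun t : ℝ => ENNReal.ofReal (√(1 + C * t + C * t ^ 2)) :=
          ENNReal.continuous_ofReal.comp (by fun_prop)
        simpa using this.tendsto 0
      have h2 : Tendsto (fun t : ℝ => ENNReal.ofReal (C * √M * t + C * t ^ 2 + C * t ^ 3))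
          (𝓝 0) (𝓝 0) := by
        have : Continuous fun t : ℝ => ENNReal.ofReal (C * √M * t + C * t ^ 2 + C * t ^ 3) :=
          ENNReal.continuous_ofReal.comp (by fun_prop)
        simpa using this.tendsto 0
      simpa using (ENNReal.Tendsto.const_mul h1 (Or.inr hGt)).add h2
    unfold localSlope
    rcases eq_or_neBot (comap (fun z => ‖b u - b z‖) (𝓝 0) ⊓ 𝓟 {u}ᶜ) with hb | hb
    · rw [hb]; simp
    · refine (limsup_le_limsup hle).trans (le_of_eq ?_)
      exact (hgc.comp (tendsto_comap.mono_left inf_le_left)).limsup_eq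
  · refine iSup₂_le fun v _ => ?_
    rcases (norm_nonneg (b u - b v)).eq_or_lt' with h0 | h0
    · rw [h0]; simp [Φ₁]
    set N := 1 / 2 * ‖a u‖ ^ 2 - 1 / 2 * ‖a v‖ ^ 2 - Φ₂ C M ‖b u - b v‖ with hN
    rcases le_or_gt N 0 with hN0 | hN0
    · rw [max_eq_right hN0]; simp
    have hpos := Φ₁_pos hC0 h0
    have hdesc := fun s (hs : s ∈ Ioo (0 : ℝ) 1) => h.exists_descent hC hM v hs
    have : Nonempty X := ⟨u⟩
    choose! z hz1 hz2 using hdesc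
    have hev : ∀ᶠ s in 𝓝[>] (0 : ℝ), s ∈ Ioo (0 : ℝ) 1 := Ioo_mem_nhdsGT one_pos
    have hlt : ∀ s ∈ Ioo (0 : ℝ) 1, 0 < 1 / 2 * ‖a u‖ ^ 2 - 1 / 2 * ‖a (z s)‖ ^ 2 := fun s hs =>
      (mul_pos hs.1 hN0).trans_le (hz1 s hs)
    have hzt : Tendsto z (𝓝[>] (0 : ℝ)) (comap (fun z => ‖b u - b z‖) (𝓝 0) ⊓ 𝓟 {u}ᶜ) := by
      refine tendsto_inf.2 ⟨tendsto_comap_iff.2 ?_, tendsto_principal.2 ?_⟩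
      · have : Tendsto (fun s : ℝ => s * Φ₁ C ‖b u - b v‖) (𝓝[>] 0) (𝓝 0) := by
          have : Continuous fun s : ℝ => s * Φ₁ C ‖b u - b v‖ := by fun_prop
          simpa using (this.tendsto 0).mono_left nhdsWithin_le_nhds
        refine squeeze_zero' (Eventually.of_forall fun s => norm_nonneg _) ?_ this
        filter_upwards [hev] with s hs using hz2 s hs
      · filter_upwards [hev] with s hs he
        have := hlt s hs
        rw [he] at this
        simp at this
    -- The points `z s` approach `u` as `s → 0⁺`, and for each of them the common factor `s` cancels
    -- in the quotient.
    refine le_limsup_of_frequently_le (hzt.frequently (Eventually.frequently ?_))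
    filter_upwards [hev] with s hs
    apply ENNReal.ofReal_le_ofReal
    have hD : 0 < ‖b u - b (z s)‖ := by
      refine (norm_nonneg _).lt_of_ne' fun h0 => ?_
      have := hlt s hs
      rw [hau _ h0] at this
      simp at this
    rw [max_eq_left hN0.le, max_eq_left (hlt s hs).le, div_le_div_iff₀ hpos hD]
    calc N * ‖b u - b (z s)‖ ≤ N * (s * Φ₁ C ‖b u - b v‖) := by
          gcongr; exact hz2 s hs
      _ = s * N * Φ₁ C ‖b u - b v‖ := by ring
      _ ≤ _ := by gcongr; exact hz1 s hs

/-- Finiteness of the slope excludes the product `⊤ * 0` when the derivative along a curve is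
estimated. -/
theorem localSlope_le (h : IsAlmostConvex a b K) (u : X) :
    localSlope (fun u v => ‖b u - b v‖) (fun u => 1 / 2 * ‖a u‖ ^ 2) u
      ≤ ENNReal.ofReal (K * ‖a u‖) := by
  refine limsup_le_of_le (by isBoundedDefault) (Eventually.of_forall fun z => ?_)
  apply ENNReal.ofReal_le_ofReal
  have hK := h.nonneg
  refine div_le_of_le_mul₀ (norm_nonneg _) (by positivity) (max_le ?_ (by positivity))
  rw [half_norm_sq_sub]
  have h1 := real_inner_le_norm (a u - a z) (a u)
  have h2 := mul_le_mul_of_nonneg_right (h.norm_sub_le u z) (norm_nonneg (a u))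
  nlinarith [sq_nonneg ‖a u - a z‖]

/-- Lower semicontinuity of the slope along families that admit mutual recovery families. -/
theorem localSlope_le_liminf (h : IsAlmostConvex a b K) {ι : Type*} {F : Filter ι} [F.NeBot]
    {z : ι → X} {u : X} {M : ℝ} (hM : ∀ᶠ i in F, 1 / 2 * ‖a (z i)‖ ^ 2 ≤ M)
    (hrec : ∀ v, ∃ v' : ι → X,
      Tendsto (fun i => 1 / 2 * ‖a (z i)‖ ^ 2 - 1 / 2 * ‖a (v' i)‖ ^ 2) F
        (𝓝 (1 / 2 * ‖a u‖ ^ 2 - 1 / 2 * ‖a v‖ ^ 2)) ∧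
      Tendsto (fun i => ‖b (z i) - b (v' i)‖) F (𝓝 ‖b u - b v‖)) :
    localSlope (fun u v => ‖b u - b v‖) (fun u => 1 / 2 * ‖a u‖ ^ 2) u ≤
      liminf (fun i => localSlope (fun u v => ‖b u - b v‖) (fun u => 1 / 2 * ‖a u‖ ^ 2) (z i)) F := by
  -- One bound `M'` serves both `u` and the `z i`, so the same `Φ²` occurs in all the suprema.
  rw [h.localSlope_eq le_rfl (M := max M (1 / 2 * ‖a u‖ ^ 2)) (le_max_right _ _)]
  set M' := max M (1 / 2 * ‖a u‖ ^ 2)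
  refine iSup₂_le fun v _ => ?_
  obtain ⟨v', h1, h2⟩ := hrec v
  rcases (norm_nonneg (b u - b v)).eq_or_lt' with h0 | h0
  · rw [h0]; simp [Φ₁]
  have hpos : 0 < Φ₁ (2 * K ^ 2) ‖b u - b v‖ := Φ₁_pos (by positivity) h0
  have hΦ1 : Continuous (Φ₁ (2 * K ^ 2)) := by unfold Φ₁; fun_prop
  have hΦ2 : Continuous (Φ₂ (2 * K ^ 2) M') := by unfold Φ₂; fun_prop
  have hlim := ENNReal.tendsto_ofReal
    (((h1.sub ((hΦ2.tendsto _).comp h2)).max tendsto_const_nhds).div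
      ((hΦ1.tendsto _).comp h2) hpos.ne' : Tendsto (fun i =>
        max (1 / 2 * ‖a (z i)‖ ^ 2 - 1 / 2 * ‖a (v' i)‖ ^ 2
          - Φ₂ (2 * K ^ 2) M' ‖b (z i) - b (v' i)‖) 0
          / Φ₁ (2 * K ^ 2) ‖b (z i) - b (v' i)‖) F _)
  rw [← hlim.liminf_eq]
  refine liminf_le_liminf ?_
  filter_upwards [hM, h2.eventually_const_lt h0] with i hi hi0
  rw [h.localSlope_eq le_rfl (M := M') (hi.trans (le_max_left _ _))]
  have hne : z i ≠ v' i := fun e => by rw [e] at hi0; simp at hi0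
  exact le_iSup₂ (f := fun (v : X) (_ : z i ≠ v) => ENNReal.ofReal
        (max (1 / 2 * ‖a (z i)‖ ^ 2 - 1 / 2 * ‖a v‖ ^ 2 - Φ₂ (2 * K ^ 2) M' ‖b (z i) - b v‖) 0
          / Φ₁ (2 * K ^ 2) ‖b (z i) - b v‖)) (v' i) hne

end IsAlmostConvex

end Abstract

/-! ### The strong upper gradient property -/

theorem absolutelyContinuousOnInterval_of_dist_le {f g : ℝ → ℝ} {s t C : ℝ}
    (hg : AbsolutelyContinuousOnInterval g s t)
    (h : ∀ x ∈ uIcc s t, ∀ y ∈ uIcc s t, dist (f x) (f y) ≤ C * dist (g x) (g y)) :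
    AbsolutelyContinuousOnInterval f s t := by
  have hlim : Tendsto (fun E : ℕ × (ℕ → ℝ × ℝ) =>
      C * ∑ i ∈ Finset.range E.1, dist (g (E.2 i).1) (g (E.2 i).2))
      (AbsolutelyContinuousOnInterval.totalLengthFilter ⊓
        𝓟 (AbsolutelyContinuousOnInterval.disjWithin s t)) (𝓝 0) := by
    simpa using Tendsto.const_mul C hg
  refine squeeze_zero' (Eventually.of_forall fun E => Finset.sum_nonneg fun _ _ => dist_nonneg) ?_
    hlim
  filter_upwards [mem_inf_of_right (mem_principal_self _)] with E hE
  rw [Finset.mul_sum]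
  exact Finset.sum_le_sum fun i hi => h _ (hE.1 i hi).1 _ (hE.1 i hi).2

/-- Extending `m` by zero gives a primitive on the whole line, to which Lebesgue differentiation
applies. -/
theorem IsACCurve.exists_primitive {X : Type*} {D : X → X → ℝ} (hsymm : ∀ x y, D x y = D y x)
    {J : Set ℝ} (hJo : IsOpen J) (hJ : J.OrdConnected) {γ : ℝ → X} (hγ : IsACCurve D J γ) :
    ∃ m : ℝ → ℝ, Integrable m ∧
      ∀ s ∈ J, ∀ t ∈ J, D (γ s) (γ t) ≤ |(∫ r in (0 : ℝ)..t, m r) - ∫ r in (0 : ℝ)..s, m r| := by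
  obtain ⟨m, hm, hD⟩ := hγ
  have hm' : Integrable (J.indicator m) := hm.integrable_indicator hJo.measurableSet
  have hi : ∀ c d, IntervalIntegrable (J.indicator m) volume c d := fun c d =>
    hm'.intervalIntegrable
  refine ⟨J.indicator m, hm', ?_⟩
  have key : ∀ s ∈ J, ∀ t ∈ J, s ≤ t → D (γ s) (γ t) ≤
      (∫ r in (0 : ℝ)..t, J.indicator m r) - ∫ r in (0 : ℝ)..s, J.indicator m r := by
    intro s hs t ht hst
    rw [intervalIntegral.integral_interval_sub_left (hi _ _) (hi _ _)]
    refine (hD s hs t ht hst).trans (le_of_eq (intervalIntegral.integral_congr fun r hr => ?_))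
    rw [uIcc_of_le hst] at hr
    exact (indicator_of_mem (hJ.out hs ht hr) m).symm
  intro s hs t ht
  rcases le_total s t with hst | hst
  · exact (key s hs t ht hst).trans (le_abs_self _)
  · rw [hsymm, abs_sub_comm]
    exact (key t ht s hs hst).trans (le_abs_self _)

section Abstract

variable {X H : Type*} [NormedAddCommGroup H] [InnerProductSpace ℝ H] {a b : X → H} {K : ℝ}

namespace IsAlmostConvex

theorem eq_of_norm_sub_eq_zero (h : IsAlmostConvex a b K) {u v : X} (huv : ‖b u - b v‖ = 0) :
    a u = a v := by
  have := h.norm_sub_le u v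
  rw [huv, mul_zero] at this
  exact sub_eq_zero.1 (norm_le_zero_iff.1 this)

/-- Where the energy lies below its value at `r`, the distance is nonzero and the positive part is
inactive. The difference quotient is then exactly the slope quotient times the metric quotient, and
the upper limit of a product is at most the product of the finite upper limits. -/
theorem enorm_deriv_le_of_filter (h : IsAlmostConvex a b K) {γ : ℝ → X} {r d : ℝ}
    (hd : HasDerivAt (fun s => 1 / 2 * ‖a (γ s)‖ ^ 2) d r)
    (hcont : Tendsto (fun s => ‖b (γ r) - b (γ s)‖) (𝓝[≠] r) (𝓝 0))
    (hfin : metricDeriv (fun u v => ‖b u - b v‖) γ r ≠ ⊤) {F : Filter ℝ} [F.NeBot]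
    (hF : F ≤ 𝓝[≠] r) (hlt : ∀ᶠ s in F, 1 / 2 * ‖a (γ s)‖ ^ 2 < 1 / 2 * ‖a (γ r)‖ ^ 2) :
    ‖d‖ₑ ≤ localSlope (fun u v => ‖b u - b v‖) (fun u => 1 / 2 * ‖a u‖ ^ 2) (γ r) *
      metricDeriv (fun u v => ‖b u - b v‖) γ r := by
  set f : ℝ → ℝ := fun s => 1 / 2 * ‖a (γ s)‖ ^ 2 with hf
  set p : ℝ → ℝ≥0∞ := fun s => ENNReal.ofReal (max (f r - f s) 0 / ‖b (γ r) - b (γ s)‖) with hp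
  set q : ℝ → ℝ≥0∞ := fun s => ENNReal.ofReal (‖b (γ s) - b (γ r)‖ / |s - r|) with hq
  have hlim : Tendsto (fun s => ‖slope f r s‖ₑ) F (𝓝 ‖d‖ₑ) :=
    ((hasDerivAt_iff_tendsto_slope.1 hd).mono_left hF).enorm
  have hpq : (fun s => ‖slope f r s‖ₑ) =ᶠ[F] p * q := by
    filter_upwards [hlt, hF self_mem_nhdsWithin] with s hs hsr
    have hD : 0 < ‖b (γ r) - b (γ s)‖ := by
      refine (norm_nonneg _).lt_of_ne' fun h0 => ?_
      rw [h.eq_of_norm_sub_eq_zero h0] at hs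
      exact lt_irrefl _ hs
    have hsr' : 0 < |s - r| := abs_pos.2 (sub_ne_zero.2 hsr)
    have hs' : f s < f r := hs
    rw [Pi.mul_apply, hp, hq, ← ENNReal.ofReal_mul (by positivity), norm_sub_rev (b (γ s)),
      ← ofReal_norm, slope_def_field, Real.norm_eq_abs, abs_div, abs_sub_comm (f s),
      abs_of_pos (sub_pos.2 hs'), max_eq_left (sub_pos.2 hs').le, div_mul_div_cancel₀ hD.ne']
  have hγ : Tendsto γ F (comap (fun z => ‖b (γ r) - b z‖) (𝓝 0) ⊓ 𝓟 {γ r}ᶜ) := by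
    refine tendsto_inf.2 ⟨tendsto_comap_iff.2 (hcont.mono_left hF), tendsto_principal.2 ?_⟩
    filter_upwards [hlt] with s hs he
    rw [he] at hs
    exact lt_irrefl _ hs
  have hp_le : limsup p F ≤ localSlope (fun u v => ‖b u - b v‖) (fun u => 1 / 2 * ‖a u‖ ^ 2) (γ r) :=
    limsup_le_limsup_of_le (u := fun z => ENNReal.ofReal
      (max (1 / 2 * ‖a (γ r)‖ ^ 2 - 1 / 2 * ‖a z‖ ^ 2) 0 / ‖b (γ r) - b z‖)) hγ
  have hq_le : limsup q F ≤ metricDeriv (fun u v => ‖b u - b v‖) γ r := limsup_le_limsup_of_le hF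
  rw [← hlim.limsup_eq, limsup_congr hpq]
  refine (ENNReal.limsup_mul_le' (Or.inr (ne_top_of_le_ne_top hfin hq_le)) (Or.inl
    (ne_top_of_le_ne_top ENNReal.ofReal_ne_top (hp_le.trans (h.localSlope_le _))))).trans ?_
  exact mul_le_mul' hp_le hq_le

/-- The slope sees only decrease of the energy, so `r` is approached from the right if `d < 0` and
from the left if `d > 0`. -/
theorem enorm_deriv_le (h : IsAlmostConvex a b K) {γ : ℝ → X} {r d : ℝ}
    (hd : HasDerivAt (fun s => 1 / 2 * ‖a (γ s)‖ ^ 2) d r)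
    (hcont : Tendsto (fun s => ‖b (γ r) - b (γ s)‖) (𝓝[≠] r) (𝓝 0))
    (hfin : metricDeriv (fun u v => ‖b u - b v‖) γ r ≠ ⊤) :
    ‖d‖ₑ ≤ localSlope (fun u v => ‖b u - b v‖) (fun u => 1 / 2 * ‖a u‖ ^ 2) (γ r) *
      metricDeriv (fun u v => ‖b u - b v‖) γ r := by
  have hs := hasDerivAt_iff_tendsto_slope.1 hd
  rcases lt_trichotomy d 0 with h0 | h0 | h0
  · have hF : 𝓝[>] r ≤ 𝓝[≠] r := nhdsWithin_mono _ fun s hs => ne_of_gt hs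
    refine h.enorm_deriv_le_of_filter hd hcont hfin hF ?_
    filter_upwards [(hs.mono_left hF).eventually_lt_const h0, self_mem_nhdsWithin] with s h1 h2
    have := sub_smul_slope (fun s => 1 / 2 * ‖a (γ s)‖ ^ 2) r s
    rw [smul_eq_mul] at this
    have h3 := mul_neg_of_pos_of_neg (sub_pos.2 h2) h1
    simp only [vsub_eq_sub] at this
    linarith
  · simp [h0]
  · have hF : 𝓝[<] r ≤ 𝓝[≠] r := nhdsWithin_mono _ fun s hs => ne_of_lt hs
    refine h.enorm_deriv_le_of_filter hd hcont hfin hF ?_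
    filter_upwards [(hs.mono_left hF).eventually_const_lt h0, self_mem_nhdsWithin] with s h1 h2
    have := sub_smul_slope (fun s => 1 / 2 * ‖a (γ s)‖ ^ 2) r s
    rw [smul_eq_mul] at this
    have h3 := mul_neg_of_neg_of_pos (sub_neg.2 h2) h1
    simp only [vsub_eq_sub] at this
    linarith

theorem abs_half_norm_sq_sub_le (h : IsAlmostConvex a b K) {N : ℝ} {u v : X} (hu : ‖a u‖ ≤ N)
    (hv : ‖a v‖ ≤ N) :
    |1 / 2 * ‖a u‖ ^ 2 - 1 / 2 * ‖a v‖ ^ 2| ≤ N * K * ‖b u - b v‖ := by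
  have hN : 0 ≤ N := (norm_nonneg _).trans hu
  have e : 1 / 2 * ‖a u‖ ^ 2 - 1 / 2 * ‖a v‖ ^ 2
      = (‖a u‖ + ‖a v‖) / 2 * (‖a u‖ - ‖a v‖) := by ring
  rw [e, abs_mul, abs_of_nonneg (by positivity), mul_assoc]
  exact mul_le_mul (by linarith) ((abs_norm_sub_norm_le _ _).trans (h.norm_sub_le u v))
    (abs_nonneg _) hN

/-- Lower semicontinuity is needed only for measurability. On a compact time interval `‖a‖` is
bounded along the curve, so increments of the energy are controlled by those of the absolutely
continuous `G`. -/
theorem isStrongUpperGradient (h : IsAlmostConvex a b K)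
    (hlsc : ∀ (ι : Type) (F : Filter ι) (_ : F.NeBot) (z : ι → X) (u : X),
      Tendsto (fun i => ‖b u - b (z i)‖) F (𝓝 0) →
      localSlope (fun u v => ‖b u - b v‖) (fun u => 1 / 2 * ‖a u‖ ^ 2) u ≤ liminf (fun i =>
        localSlope (fun u v => ‖b u - b v‖) (fun u => 1 / 2 * ‖a u‖ ^ 2) (z i)) F) :
    IsStrongUpperGradient (fun u v => ‖b u - b v‖) (fun u => 1 / 2 * ‖a u‖ ^ 2)
      (localSlope (fun u v => ‖b u - b v‖) (fun u => 1 / 2 * ‖a u‖ ^ 2)) := by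
  intro J γ hJo hJ hγ
  obtain ⟨m, hm, hD⟩ := hγ.exists_primitive (fun x y => norm_sub_rev _ _) hJo hJ
  set G : ℝ → ℝ := fun x => ∫ r in (0 : ℝ)..x, m r with hG
  have hGc : Continuous G :=
    intervalIntegral.continuous_primitive (fun _ _ => hm.intervalIntegrable) 0
  have hK := h.nonneg
  have hG0 : ∀ r, Tendsto (fun s => |G s - G r|) (𝓝 r) (𝓝 0) := fun r => by
    have : Continuous fun s => |G s - G r| := by fun_prop
    simpa using this.tendsto r
  constructor
  · apply LowerSemicontinuous.measurable
    intro t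
    refine lowerSemicontinuousAt_iff_le_liminf.2 ?_
    refine hlsc J (𝓝 t) inferInstance (fun s => γ s) (γ t) ?_
    refine squeeze_zero (fun _ => norm_nonneg _) (fun s => hD t t.2 s s.2) ?_
    exact (hG0 t).comp (continuous_subtype_val.tendsto t)
  · intro s hs t ht hst
    have hsub : Icc s t ⊆ J := hJ.out hs ht
    obtain ⟨c, hc⟩ : ∃ c, ∀ x ∈ Icc s t, |G x - G s| ≤ c := by
      have hcont : Continuous fun x => |G x - G s| := by fun_prop
      obtain ⟨c, hc⟩ := (isCompact_Icc (a := s) (b := t)).bddAbove_image hcont.continuousOn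
      exact ⟨c, fun x hx => hc (mem_image_of_mem _ hx)⟩
    have hN : ∀ x ∈ Icc s t, ‖a (γ x)‖ ≤ ‖a (γ s)‖ + K * c := fun x hx => by
      have h1 : ‖a (γ x)‖ ≤ ‖a (γ s)‖ + ‖a (γ s) - a (γ x)‖ := by
        rw [norm_sub_rev]; exact norm_le_norm_add_norm_sub' _ _
      have h2 := (h.norm_sub_le (γ s) (γ x)).trans
        (mul_le_mul_of_nonneg_left ((hD s hs x (hsub hx)).trans (hc x hx)) hK)
      linarith
    set N := ‖a (γ s)‖ + K * c
    have hN0 : 0 ≤ N := (norm_nonneg _).trans (hN s (left_mem_Icc.2 hst))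
    set f : ℝ → ℝ := fun x => 1 / 2 * ‖a (γ x)‖ ^ 2 with hf
    have hac : AbsolutelyContinuousOnInterval f s t := by
      refine absolutelyContinuousOnInterval_of_dist_le (g := G) (C := N * K) ?_ ?_
      · have h1 : AbsolutelyContinuousOnInterval (fun x => ∫ r in s..x, m r) s t :=
          hm.intervalIntegrable.absolutelyContinuousOnInterval_intervalIntegral left_mem_uIcc
        refine absolutelyContinuousOnInterval_of_dist_le (C := 1) h1 fun x _ y _ => le_of_eq ?_
        have e : ∀ x, G x = G s + ∫ r in s..x, m r := fun x =>
          (intervalIntegral.integral_add_adjacent_intervals hm.intervalIntegrable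
            hm.intervalIntegrable).symm
        rw [e x, e y, dist_add_left, one_mul]
      · intro x hx y hy
        rw [uIcc_of_le hst] at hx hy
        rw [dist_comm (G x), Real.dist_eq, Real.dist_eq]
        exact (h.abs_half_norm_sq_sub_le (hN x hx) (hN y hy)).trans
          (mul_le_mul_of_nonneg_left (hD x (hsub hx) y (hsub hy)) (by positivity))
    have hft : 1 / 2 * ‖a (γ t)‖ ^ 2 - 1 / 2 * ‖a (γ s)‖ ^ 2 = ∫ x in Ioo s t, deriv f x := by
      rw [← integral_Ioc_eq_integral_Ioo, ← intervalIntegral.integral_of_le hst,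
        hac.integral_deriv_eq_sub]
    rw [hft, ← Real.norm_eq_abs, ofReal_norm]
    refine (enorm_integral_le_lintegral_enorm _).trans (lintegral_mono_ae ?_)
    rw [ae_restrict_iff' measurableSet_Ioo]
    filter_upwards [hac.ae_differentiableAt, LocallyIntegrable.ae_hasDerivAt_integral hm.locallyIntegrable]
      with r h1 h2 hr
    have hrI : r ∈ Icc s t := Ioo_subset_Icc_self hr
    have hev : ∀ᶠ x in 𝓝[≠] r, x ∈ J := nhdsWithin_le_nhds (hJo.mem_nhds (hsub hrI))
    refine h.enorm_deriv_le (h1 (by rwa [uIcc_of_le hst])).hasDerivAt ?_ ?_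
    · refine squeeze_zero' (Eventually.of_forall fun _ => norm_nonneg _) ?_
        ((hG0 r).mono_left nhdsWithin_le_nhds)
      filter_upwards [hev] with x hx using hD r (hsub hrI) x hx
    -- At points where `G` has derivative `m r`, the metric derivative is at most `|m r|`, hence
    -- finite.
    · have hlim := ((hasDerivAt_iff_tendsto_slope.1 (h2 0)).enorm).limsup_eq
      refine ne_top_of_le_ne_top (enorm_ne_top (x := m r)) (hlim ▸ limsup_le_limsup ?_)
      filter_upwards [hev] with x hx
      rw [← ofReal_norm, slope_def_field, Real.norm_eq_abs, abs_div]
      apply ENNReal.ofReal_le_ofReal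
      gcongr
      rw [abs_sub_comm]
      exact hD x hx r (hsub hrI)

end IsAlmostConvex

end Abstract

/-! ### Weak derivatives on an interval -/

section Interval

variable {c d : ℝ}

theorem _root_.MeasureTheory.IntegrableOn.mul_continuous_Ioo {f ψ : ℝ → ℝ}
    (hf : IntegrableOn f (Ioo c d)) (hψ : Continuous ψ) :
    IntegrableOn (fun x => f x * ψ x) (Ioo c d) := by
  obtain ⟨C, hC⟩ := (isCompact_Icc (a := c) (b := d)).exists_bound_of_continuousOn
    hψ.continuousOn
  refine hf.integrable.mul_bdd (c := C) hψ.aestronglyMeasurable ?_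
  rw [ae_restrict_iff' measurableSet_Ioo]
  exact Eventually.of_forall fun x hx => hC x (Ioo_subset_Icc_self hx)

theorem integrableOn_primitive (hcd : c ≤ d) {f : ℝ → ℝ} (hf : IntegrableOn f (Ioo c d)) :
    IntegrableOn (fun x => ∫ r in c..x, f r) (Ioo c d) := by
  have hfi : IntervalIntegrable f volume c d :=
    (intervalIntegrable_iff_integrableOn_Ioo_of_le hcd).2 hf
  have hac := hfi.absolutelyContinuousOnInterval_intervalIntegral left_mem_uIcc
  have := hac.continuousOn
  rw [uIcc_of_le hcd] at this
  exact this.integrableOn_Icc.mono_set Ioo_subset_Icc_self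

/-- Integration by parts for a primitive and a smooth function. -/
theorem setIntegral_primitive_mul_deriv (hcd : c ≤ d) {f : ℝ → ℝ} (hf : IntegrableOn f (Ioo c d))
    {φ : ℝ → ℝ} (hφ : ContDiff ℝ ∞ φ) :
    ∫ x in Ioo c d, ((∫ r in c..x, f r) * deriv φ x + f x * φ x)
      = (∫ r in c..d, f r) * φ d := by
  have hfi : IntervalIntegrable f volume c d :=
    (intervalIntegrable_iff_integrableOn_Ioo_of_le hcd).2 hf
  have hac := hfi.absolutelyContinuousOnInterval_intervalIntegral (left_mem_uIcc)
  have hφac : AbsolutelyContinuousOnInterval φ c d :=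
    (hφ.of_le (by simp)).contDiffOn.absolutelyContinuousOnInterval
  have key := hac.integral_deriv_mul_eq_sub hφac
  rw [intervalIntegral.integral_same, zero_mul, sub_zero] at key
  rw [← key, ← integral_Ioc_eq_integral_Ioo, ← intervalIntegral.integral_of_le hcd]
  refine intervalIntegral.integral_congr_ae ?_
  filter_upwards [hfi.ae_hasDerivAt_integral] with x hx hxm
  rw [(hx (uIoc_subset_uIcc hxm) c left_mem_uIcc).deriv, add_comm]

/-- The primitive starting at `c` vanishes to the left of `K` since `η` does, and to the right of
`K` since the total integral is zero. -/
theorem exists_contDiff_deriv_eq {η : ℝ → ℝ} (hη : ContDiff ℝ ∞ η) {K : Set ℝ} (hK : IsCompact K)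
    (hKI : K ⊆ Ioo c d) (hηK : ∀ x ∉ K, η x = 0) (h0 : ∫ x, η x = 0) :
    ∃ φ : ℝ → ℝ, ContDiff ℝ ∞ φ ∧ HasCompactSupport φ ∧ tsupport φ ⊆ Ioo c d ∧ deriv φ = η := by
  rcases K.eq_empty_or_nonempty with rfl | hne
  · refine ⟨0, contDiff_const, HasCompactSupport.zero, by simp [tsupport], ?_⟩
    ext x
    simp [hηK]
  have hinf := hKI (hK.sInf_mem hne)
  have hsup := hKI (hK.sSup_mem hne)
  have hlo : ∀ x ∈ K, sInf K ≤ x := fun x hx => csInf_le hK.bddBelow hx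
  have hhi : ∀ x ∈ K, x ≤ sSup K := fun x hx => le_csSup hK.bddAbove hx
  set φ : ℝ → ℝ := fun x => ∫ r in c..x, η r with hφ
  have hder : ∀ x, HasDerivAt φ (η x) x := fun x =>
    intervalIntegral.integral_hasDerivAt_right (hη.continuous.intervalIntegrable _ _)
      (hη.continuous.stronglyMeasurableAtFilter _ _) hη.continuous.continuousAt
  have hderiv : deriv φ = η := funext fun x => (hder x).deriv
  have hsupp : tsupport φ ⊆ Icc (sInf K) (sSup K) := by
    refine closure_minimal (fun x hx => ?_) isClosed_Icc
    by_contra hxI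
    refine hx ?_
    rw [mem_Icc, not_and_or, not_le, not_le] at hxI
    rcases hxI with h | h
    · refine (intervalIntegral.integral_congr fun y hy => ?_).trans intervalIntegral.integral_zero
      refine hηK y fun hyK => ?_
      have h1 := hlo y hyK
      have h2 := hy.2
      rcases le_max_iff.1 h2 with h3 | h3
      · exact absurd hinf.1 (by linarith)
      · linarith
    · rw [hφ, ← h0]
      refine intervalIntegral.integral_eq_integral_of_support_subset fun y hy => ?_
      have hyK : y ∈ K := by_contra fun h' => hy (hηK y h')
      exact ⟨(hKI hyK).1, (hhi y hyK).trans h.le⟩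
  refine ⟨φ, contDiff_infty_iff_deriv.2 ⟨fun x => (hder x).differentiableAt, hderiv ▸ hη⟩,
    HasCompactSupport.of_support_subset_isCompact isCompact_Icc
      (subset_closure.trans hsupp), hsupp.trans fun x hx => ?_, hderiv⟩
  exact ⟨hinf.1.trans_le hx.1, hx.2.trans_lt hsup.2⟩

/-- A function with vanishing weak derivative is constant. -/
theorem exists_ae_eq_const_of_integral_mul_deriv_eq_zero (hcd : c < d) {f : ℝ → ℝ}
    (hf : IntegrableOn f (Ioo c d))
    (h : ∀ φ : ℝ → ℝ, ContDiff ℝ ∞ φ → HasCompactSupport φ → tsupport φ ⊆ Ioo c d →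
      ∫ x in Ioo c d, f x * deriv φ x = 0) :
    ∃ k, ∀ᵐ x ∂volume.restrict (Ioo c d), f x = k := by
  let B : ContDiffBump ((c + d) / 2) := ⟨(d - c) / 8, (d - c) / 4, by linarith, by linarith⟩
  have hBI : tsupport (B.normed volume) ⊆ Ioo c d := by
    rw [B.tsupport_normed_eq, Real.closedBall_eq_Icc]
    intro x hx
    have h1 : (c + d) / 2 - (d - c) / 4 ≤ x := hx.1
    have h2 : x ≤ (c + d) / 2 + (d - c) / 4 := hx.2
    constructor <;> linarith
  set ρ := B.normed volume with hρ
  have hρs : ContDiff ℝ ∞ ρ := B.contDiff_normed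
  have hρc : HasCompactSupport ρ := B.hasCompactSupport_normed
  have hρ1 : ∫ x, ρ x = 1 := B.integral_normed
  set k := ∫ x in Ioo c d, f x * ρ x with hk
  refine ⟨k, ?_⟩
  have hae := isOpen_Ioo.ae_eq_zero_of_integral_contDiff_smul_eq_zero
    (f := fun x => f x - k) (U := Ioo c d) (μ := volume)
    ((hf.sub (integrableOn_const (by simp))).locallyIntegrableOn) ?_
  · rw [ae_restrict_iff' measurableSet_Ioo]
    filter_upwards [hae] with x hx hxI using sub_eq_zero.1 (hx hxI)
  intro ψ hψ hψc hψI
  -- Du Bois-Reymond: subtracting `(∫ ψ) ρ`, with `ρ` of unit mass, leaves a function of zero mass,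
  -- which is the derivative of a test function.
  obtain ⟨φ, hφ, hφc, hφI, hφd⟩ := exists_contDiff_deriv_eq
    (η := fun x => ψ x - (∫ y, ψ y) * ρ x) (hψ.sub (contDiff_const.mul hρs))
    (hψc.isCompact.union hρc.isCompact) (union_subset hψI hBI) (fun x hx => by
      rw [mem_union, not_or] at hx
      simp [image_eq_zero_of_notMem_tsupport hx.1, image_eq_zero_of_notMem_tsupport hx.2]) (by
      rw [integral_sub (hψ.continuous.integrable_of_hasCompactSupport hψc)
        ((hρs.continuous.integrable_of_hasCompactSupport hρc).const_mul _), integral_const_mul, hρ1]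
      ring)
  have h1 := h φ hφ hφc hφI
  rw [hφd] at h1
  have e1 : ∫ x in Ioo c d, f x * (ψ x - (∫ y, ψ y) * ρ x)
      = (∫ x in Ioo c d, f x * ψ x) - (∫ y, ψ y) * k := by
    rw [hk, ← integral_const_mul, ← integral_sub (hf.mul_continuous_Ioo hψ.continuous)
      ((hf.mul_continuous_Ioo hρs.continuous).const_mul _)]
    refine integral_congr_ae (Eventually.of_forall fun x => ?_)
    simp only
    ring
  rw [e1] at h1
  have e2 : ∫ x in Ioo c d, ψ x = ∫ x, ψ x :=
    setIntegral_eq_integral_of_forall_compl_eq_zero fun x hx =>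
      image_eq_zero_of_notMem_tsupport fun h' => hx (hψI h')
  have e3 : ∫ x, ψ x • (f x - k) = ∫ x in Ioo c d, ψ x • (f x - k) :=
    (setIntegral_eq_integral_of_forall_compl_eq_zero fun x hx => by
      rw [image_eq_zero_of_notMem_tsupport fun h' => hx (hψI h'), zero_smul]).symm
  have e4 : ∫ x in Ioo c d, ψ x • (f x - k)
      = (∫ x in Ioo c d, f x * ψ x) - k * ∫ x in Ioo c d, ψ x := by
    rw [← integral_const_mul, ← integral_sub (hf.mul_continuous_Ioo hψ.continuous)
      ((hψ.continuous.integrable_of_hasCompactSupport hψc).integrableOn.const_mul _)]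
    refine integral_congr_ae (Eventually.of_forall fun x => ?_)
    simp only [smul_eq_mul]
    ring
  rw [e3, e4, e2]
  linarith

theorem HasZeroTrace.hasWeakDeriv {f f' : ℝ → ℝ} (hf : IntegrableOn f (Ioo c d))
    (hf' : IntegrableOn f' (Ioo c d)) (h : HasZeroTrace (Ioo c d) 1 f f') :
    HasWeakDeriv (Ioo c d) 1 f f' := by
  intro φ hφ hφc hφI
  have := h φ hφ hφc
  rw [integral_add (hf.mul_continuous_Ioo (continuous_dirDeriv hφ)) (hf'.mul_continuous_Ioo hφ.continuous)] at this
  linarith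

theorem HasWeakDeriv.exists_ae_eq_primitive_add_const (hcd : c < d) {f f' : ℝ → ℝ}
    (hf : IntegrableOn f (Ioo c d)) (hf' : IntegrableOn f' (Ioo c d))
    (h : HasWeakDeriv (Ioo c d) 1 f f') :
    ∃ k, ∀ᵐ x ∂volume.restrict (Ioo c d), f x = (∫ r in c..x, f' r) + k := by
  have hG := integrableOn_primitive hcd.le hf'
  obtain ⟨k, hk⟩ := exists_ae_eq_const_of_integral_mul_deriv_eq_zero hcd
    (f := fun x => f x - ∫ r in c..x, f' r) (hf.sub hG) (fun φ hφ hφc hφI => by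
      have hφ' : Continuous (deriv φ) := hφ.continuous_deriv (by simp)
      have h1 := h φ hφ hφc hφI
      simp only [fderiv_apply_one_eq_deriv] at h1
      have h2 := setIntegral_primitive_mul_deriv hcd.le hf' hφ
      rw [image_eq_zero_of_notMem_tsupport fun hd => lt_irrefl d (hφI hd).2, mul_zero,
        integral_add (hG.mul_continuous_Ioo hφ') (hf'.mul_continuous_Ioo hφ.continuous)] at h2
      simp only [sub_mul]
      rw [integral_sub (hf.mul_continuous_Ioo hφ') (hG.mul_continuous_Ioo hφ'), h1]
      linarith)
  refine ⟨k, ?_⟩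
  filter_upwards [hk] with x hx
  linarith

/-- Testing with a function that is `1` at `c` and `0` at `d` isolates the boundary value at `c`, so
the constant of integration vanishes. -/
theorem HasZeroTrace.ae_eq_primitive (hcd : c < d) {f f' : ℝ → ℝ}
    (hf : IntegrableOn f (Ioo c d)) (hf' : IntegrableOn f' (Ioo c d))
    (h : HasZeroTrace (Ioo c d) 1 f f') :
    ∀ᵐ x ∂volume.restrict (Ioo c d), f x = ∫ r in c..x, f' r := by
  obtain ⟨k, hk⟩ := (h.hasWeakDeriv hf hf').exists_ae_eq_primitive_add_const hcd hf hf'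
  have hG := integrableOn_primitive hcd.le hf'
  let B : ContDiffBump c := ⟨(d - c) / 3, (d - c) / 2, by linarith, by linarith⟩
  have hB : ContDiff ℝ ∞ B := B.contDiff
  have hB' : Continuous (deriv B) := hB.continuous_deriv (by simp)
  have hBc : B c = 1 := B.one_of_mem_closedBall (by simpa using B.rIn_pos.le)
  have hBd : B d = 0 := B.zero_of_le_dist (by
    rw [Real.dist_eq, abs_of_pos (by linarith)]
    change (d - c) / 2 ≤ _
    linarith)
  have h0 := h B hB B.hasCompactSupport
  have h1 := setIntegral_primitive_mul_deriv hcd.le hf' hB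
  rw [hBd, mul_zero] at h1
  have h2 : ∫ x in Ioo c d, deriv B x = -1 := by
    rw [← integral_Ioc_eq_integral_Ioo, ← intervalIntegral.integral_of_le hcd.le,
      intervalIntegral.integral_deriv_eq_sub (fun x _ => (hB.differentiable (by simp)) x)
        (hB'.intervalIntegrable _ _), hBc, hBd]
    norm_num
  have h3 : ∫ x in Ioo c d, (f x * fderiv ℝ B x 1 + f' x * B x)
      = (∫ x in Ioo c d, ((∫ r in c..x, f' r) * deriv B x + f' x * B x))
        + k * ∫ x in Ioo c d, deriv B x := by
    have hB'i : IntegrableOn (deriv B) (Ioo c d) :=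
      hB'.continuousOn.integrableOn_Icc.mono_set Ioo_subset_Icc_self
    have hi : IntegrableOn (fun x => (∫ r in c..x, f' r) * deriv B x + f' x * B x) (Ioo c d) :=
      (hG.mul_continuous_Ioo hB').add (hf'.mul_continuous_Ioo hB.continuous)
    rw [← integral_const_mul, ← integral_add hi (hB'i.const_mul _)]
    refine integral_congr_ae ?_
    filter_upwards [hk] with x hx
    rw [hx, fderiv_apply_one_eq_deriv]
    ring
  rw [h0, h1, h2] at h3
  have hk0 : k = 0 := by linarith
  filter_upwards [hk] with x hx
  rw [hx, hk0, add_zero]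

end Interval

/-! ### Bounded functions and products in `L²` -/

section L2

variable {l : ℝ}

theorem integrableOn_L2I (f : L2I l) : IntegrableOn f (I l) := by
  have : IsFiniteMeasure (volume.restrict (I l)) := ⟨by simp [I]⟩
  exact (Lp.memLp f).integrable (by norm_num)

theorem volume_restrict_I_ne_top (s : Set ℝ) : volume.restrict (I l) s ≠ ⊤ :=
  have : IsFiniteMeasure (volume.restrict (I l)) := ⟨by simp [I]⟩
  measure_ne_top _ _

/-- The indicator function of `(-l/2, x]` as an element of `L²(I)`. -/
def leftIndicator (l x : ℝ) : L2I l :=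
  indicatorConstLp 2 (measurableSet_Ioc (a := -(l / 2)) (b := x)) (volume_restrict_I_ne_top _) 1

theorem norm_leftIndicator_le (hl : 0 ≤ l) (x : ℝ) : ‖leftIndicator l x‖ ≤ √l := by
  refine norm_indicatorConstLp_le.trans ?_
  rw [norm_one, one_mul, ENNReal.toReal_ofNat, ← Real.sqrt_eq_rpow]
  apply Real.sqrt_le_sqrt
  have : (volume.restrict (I l)).real univ = l := by simp [I, Measure.real, hl]
  have : IsFiniteMeasure (volume.restrict (I l)) := ⟨by simp [I]⟩
  calc _ ≤ (volume.restrict (I l)).real univ := measureReal_mono (subset_univ _)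
    _ = l := by assumption

/-- Evaluating a primitive is a bounded functional of `f`: this yields the sup bound, and turns weak
convergence of derivatives into pointwise convergence. -/
theorem inner_leftIndicator (f : L2I l) {x : ℝ} (hx : x ∈ I l) :
    inner ℝ (leftIndicator l x) f = ∫ r in (-(l / 2))..x, f r := by
  rw [leftIndicator, L2.inner_indicatorConstLp_one, intervalIntegral.integral_of_le hx.1.le,
    Measure.restrict_restrict measurableSet_Ioc, inter_eq_left.2]
  exact fun y hy => ⟨hy.1, hy.2.trans_lt hx.2⟩

theorem HasZeroTrace.ae_eq_inner (hl : 0 < l) {f f' : L2I l} (h : HasZeroTrace (I l) 1 f f') :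
    ∀ᵐ x ∂volume.restrict (I l), f x = inner ℝ (leftIndicator l x) f' := by
  filter_upwards [HasZeroTrace.ae_eq_primitive (by linarith) (integrableOn_L2I f) (integrableOn_L2I f') h,
    ae_restrict_mem measurableSet_Ioo] with x hx hxI
  rw [hx, inner_leftIndicator f' hxI]

theorem HasZeroTrace.ae_abs_le (hl : 0 < l) {f f' : L2I l} (h : HasZeroTrace (I l) 1 f f') :
    ∀ᵐ x ∂volume.restrict (I l), |f x| ≤ √l * ‖f'‖ := by
  filter_upwards [h.ae_eq_inner hl] with x hx
  rw [hx]
  exact (abs_real_inner_le_norm _ _).trans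
    (mul_le_mul_of_nonneg_right (norm_leftIndicator_le hl.le x) (norm_nonneg _))

/-- Essentially bounded elements of `L²(I)`. -/
def EssBounded (f : L2I l) : Prop := ∃ B, ∀ᵐ x ∂volume.restrict (I l), |f x| ≤ B

theorem HasWeakDeriv.essBounded (hl : 0 < l) {f f' : L2I l} (h : HasWeakDeriv (I l) 1 f f') :
    EssBounded f := by
  obtain ⟨k, hk⟩ := HasWeakDeriv.exists_ae_eq_primitive_add_const (by linarith) (integrableOn_L2I f)
    (integrableOn_L2I f') h
  refine ⟨√l * ‖f'‖ + |k|, ?_⟩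
  filter_upwards [hk, ae_restrict_mem measurableSet_Ioo] with x hx hxI
  rw [hx, ← inner_leftIndicator f' hxI]
  refine (abs_add_le _ _).trans (add_le_add_left ?_ _)
  exact (abs_real_inner_le_norm _ _).trans
    (mul_le_mul_of_nonneg_right (norm_leftIndicator_le hl.le x) (norm_nonneg _))

/-- The cross section has length one, so passing from functions on `I` to functions on `S` preserves
`L²` norms. -/
theorem measurePreserving_fst_S :
    MeasurePreserving Prod.fst (volume.restrict (S l)) (volume.restrict (I l)) := by
  have : IsProbabilityMeasure (volume.restrict (Ioo (-(1 / 2) : ℝ) (1 / 2))) :=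
    ⟨by simp; norm_num⟩
  rw [S, Measure.volume_eq_prod, ← Measure.prod_restrict]
  exact measurePreserving_fst

/-- The product of two functions on `I`, as a function on `S` (zero if it is not in `L²`). -/
def mulLift (f g : L2I l) : L2S l :=
  open Classical in
  if h : MemLp (fun x : ℝ × ℝ => f x.1 * g x.1) 2 (volume.restrict (S l)) then h.toLp _ else 0

theorem memLp_lift (f : L2I l) : MemLp (fun x : ℝ × ℝ => f x.1) 2 (volume.restrict (S l)) :=
  (Lp.memLp f).comp_measurePreserving measurePreserving_fst_S

theorem EssBounded.memLp_mul {f : L2I l} (hf : EssBounded f) (g : L2I l) :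
    MemLp (fun x : ℝ × ℝ => f x.1 * g x.1) 2 (volume.restrict (S l)) := by
  obtain ⟨B, hB⟩ := hf
  refine (memLp_lift g).of_le_mul (c := B)
    ((memLp_lift f).aestronglyMeasurable.mul (memLp_lift g).aestronglyMeasurable) ?_
  filter_upwards [measurePreserving_fst_S.quasiMeasurePreserving.ae hB] with x hx
  rw [norm_mul]
  exact mul_le_mul_of_nonneg_right hx (norm_nonneg _)

theorem EssBounded.coeFn_mulLift {f : L2I l} (hf : EssBounded f) (g : L2I l) :
    mulLift f g =ᵐ[volume.restrict (S l)] fun x => f x.1 * g x.1 := by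
  rw [mulLift, dif_pos (hf.memLp_mul g)]
  exact MemLp.coeFn_toLp _

theorem norm_mulLift_le {f : L2I l} {B : ℝ} (hB : ∀ᵐ x ∂volume.restrict (I l), |f x| ≤ B)
    (g : L2I l) : ‖mulLift f g‖ ≤ B * ‖g‖ := by
  rw [← Lp.norm_compMeasurePreserving g (measurePreserving_fst_S (l := l))]
  refine Lp.norm_le_mul_norm_of_ae_le_mul ?_
  filter_upwards [measurePreserving_fst_S.quasiMeasurePreserving.ae hB,
    EssBounded.coeFn_mulLift ⟨B, hB⟩ g,
    Lp.coeFn_compMeasurePreserving g (measurePreserving_fst_S (l := l))] with x h1 h2 h3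
  rw [h2, h3, norm_mul]
  exact mul_le_mul_of_nonneg_right h1 (norm_nonneg _)

theorem ae_S_of_ae_I {p : ℝ → Prop} (h : ∀ᵐ x ∂volume.restrict (I l), p x) :
    ∀ᵐ x ∂volume.restrict (S l), p x.1 :=
  measurePreserving_fst_S.quasiMeasurePreserving.ae h

theorem mulLift_add_smul_self {f g h : L2I l} (hf : EssBounded f) (hg : EssBounded g)
    (hh : EssBounded h) {s : ℝ} (e : h = f + s • g) :
    mulLift h h = mulLift f f + (2 * s) • mulLift f g + (s ^ 2) • mulLift g g := by
  apply Lp.ext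
  have h1 := ae_S_of_ae_I (Lp.coeFn_add f (s • g))
  have h2 := ae_S_of_ae_I (Lp.coeFn_smul s g)
  filter_upwards [h1, h2, hh.coeFn_mulLift h, hf.coeFn_mulLift f, hf.coeFn_mulLift g,
    hg.coeFn_mulLift g, Lp.coeFn_add (mulLift f f + (2 * s) • mulLift f g) ((s ^ 2) • mulLift g g),
    Lp.coeFn_add (mulLift f f) ((2 * s) • mulLift f g), Lp.coeFn_smul (2 * s) (mulLift f g),
    Lp.coeFn_smul (s ^ 2) (mulLift g g)] with x h1 h2 h3 h4 h5 h6 h7 h8 h9 h10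
  rw [h3, h7, Pi.add_apply, h8, Pi.add_apply, h9, h10, Pi.smul_apply, Pi.smul_apply, h4, h5, h6, e,
    h1, Pi.add_apply, h2, Pi.smul_apply]
  simp only [smul_eq_mul]
  ring

theorem mulLift_sub_left {f g h k : L2I l} (hf : EssBounded f) (hg : EssBounded g)
    (hk : EssBounded k) (e : k = f - g) : mulLift f h - mulLift g h = mulLift k h := by
  apply Lp.ext
  filter_upwards [ae_S_of_ae_I (Lp.coeFn_sub f g), hk.coeFn_mulLift h, hf.coeFn_mulLift h,
    hg.coeFn_mulLift h, Lp.coeFn_sub (mulLift f h) (mulLift g h)] with x h1 h2 h3 h4 h5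
  rw [h5, Pi.sub_apply, h3, h4, h2, e, h1, Pi.sub_apply, sub_mul]

theorem mulLift_comm (f g : L2I l) : mulLift f g = mulLift g f := by
  unfold mulLift
  rw [show (fun x : ℝ × ℝ => f x.1 * g x.1) = fun x => g x.1 * f x.1 from
    funext fun x => mul_comm _ _]

end L2

/-! ### The relaxed quadratic forms -/

theorem iInf_mul_add_sq_add {g : ℝ} (hg : 0 ≤ g) (t r : ℝ) :
    ⨅ α : ℝ, (g * (α + t) ^ 2 + r) = r := by
  have hle : ∀ α : ℝ, r ≤ g * (α + t) ^ 2 + r := fun α => by nlinarith [mul_nonneg hg (sq_nonneg (α + t))]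
  refine le_antisymm ?_ (le_ciInf hle)
  refine (ciInf_le ⟨r, forall_mem_range.2 hle⟩ (-t)).trans (le_of_eq ?_)
  simp

theorem exists_polynomial_form (Q : QuadraticForm ℝ (Matrix (Fin 2) (Fin 2) ℝ)) :
    ∃ A B d e f : ℝ, ∀ p q α : ℝ, Q !![p, q; q, α] = A * p ^ 2 + B * q ^ 2 +
      Q !![0, 0; 0, 1] * α ^ 2 + d * (p * q) + e * (p * α) + f * (q * α) := by
  set E₁ : Matrix (Fin 2) (Fin 2) ℝ := !![1, 0; 0, 0]
  set E₂ : Matrix (Fin 2) (Fin 2) ℝ := !![0, 1; 1, 0]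
  set E₃ : Matrix (Fin 2) (Fin 2) ℝ := !![0, 0; 0, 1]
  refine ⟨Q E₁, Q E₂, QuadraticMap.polar Q E₁ E₂, QuadraticMap.polar Q E₁ E₃,
    QuadraticMap.polar Q E₂ E₃, fun p q α => ?_⟩
  have h : !![p, q; q, α] = p • E₁ + q • E₂ + α • E₃ := by
    ext i j; fin_cases i <;> fin_cases j <;> simp [E₁, E₂, E₃]
  rw [h, QuadraticMap.map_add Q, QuadraticMap.map_add Q, QuadraticMap.polar_add_left]
  simp only [QuadraticMap.map_smul, QuadraticMap.polar_smul_left, QuadraticMap.polar_smul_right,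
    smul_eq_mul]
  ring

/-- Each minimisation completes a square and leaves a Schur complement. It stays positive because it
is a value of `Q` at a nonzero symmetric matrix, the minimiser. -/
theorem IsAdmissibleForm.exists_coefficients {Q : QuadraticForm ℝ (Matrix (Fin 2) (Fin 2) ℝ)}
    (hQ : IsAdmissibleForm Q) : ∃ c g k : ℝ, 0 < c ∧ 0 < g ∧
      (∀ p q, Q1 Q p q = g * (q + k * p) ^ 2 + c * p ^ 2) ∧ ∀ p, Q0 Q p = c * p ^ 2 := by
  obtain ⟨A, B, d, e, f, h⟩ := exists_polynomial_form Q
  have hpos : ∀ p q α : ℝ, (p ≠ 0 ∨ q ≠ 0 ∨ α ≠ 0) → 0 < Q !![p, q; q, α] := by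
    intro p q α hne
    refine hQ.pos _ ?_ fun h0 => ?_
    · ext i j; fin_cases i <;> fin_cases j <;> simp
    · have h00 := congrFun (congrFun h0 0) 0
      have h01 := congrFun (congrFun h0 0) 1
      have h11 := congrFun (congrFun h0 1) 1
      simp at h00 h01 h11
      simp [h00, h01, h11] at hne
  have hG := hpos 0 0 1 (by simp)
  set G := Q !![0, 0; 0, 1] with hGdef
  have hQ1 : ∀ p q, Q1 Q p q = (A - e ^ 2 / (4 * G)) * p ^ 2 + (B - f ^ 2 / (4 * G)) * q ^ 2
      + (d - e * f / (2 * G)) * (p * q) := fun p q => by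
    refine Eq.trans (congrArg iInf (funext fun α => ?_))
      (iInf_mul_add_sq_add hG.le ((e * p + f * q) / (2 * G)) _)
    rw [h]
    field_simp
    ring
  have hg : 0 < B - f ^ 2 / (4 * G) := by
    have := hpos 0 1 (-f / (2 * G)) (by simp)
    rw [h] at this
    convert this using 1
    field_simp
    ring
  set g := B - f ^ 2 / (4 * G) with hgdef
  set k := (d - e * f / (2 * G)) / (2 * g) with hk
  set c := A - e ^ 2 / (4 * G) - g * k ^ 2 with hc
  have hd : d - e * f / (2 * G) = 2 * g * k := by rw [hk]; field_simp
  have hQ1' : ∀ p q, Q1 Q p q = g * (q + k * p) ^ 2 + c * p ^ 2 := fun p q => by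
    rw [hQ1, hd, hc]; ring
  have hcpos : 0 < c := by
    -- For `p = 1` the minimisers are `q = -k` and `α = -(e - f k) / (2G)`; the value there is `c`.
    have h1 := hpos 1 (-k) (-(e - f * k) / (2 * G)) (by simp)
    have h2 : Q !![1, -k; -k, -(e - f * k) / (2 * G)] = Q1 Q 1 (-k) := by
      rw [h, hQ1, hgdef]; field_simp; ring
    rw [h2, hQ1'] at h1
    simpa using h1
  refine ⟨c, g, k, hcpos, hg, hQ1', fun p => ?_⟩
  simp only [Q0, hQ1']
  exact iInf_mul_add_sq_add hg.le _ _

/-! ### The strain map -/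

/-- The space of strains: a membrane strain on `S`, a bending and a torsion strain on `I`. -/
abbrev Strain (l : ℝ) := WithLp 2 (L2S l × WithLp 2 (L2I l × L2I l))

section StrainMap

variable {l : ℝ}

/-- The lower triangular map `(a, b, c) ↦ (α a, β b, γ c + κ b)` on the space of strains. -/
def triangular (l α β γ κ : ℝ) : Strain l →L[ℝ] Strain l :=
  (WithLp.prodContinuousLinearEquiv 2 ℝ _ _).symm.toContinuousLinearMap ∘L
    ((α • WithLp.fstL 2 ℝ _ _).prod
      ((WithLp.prodContinuousLinearEquiv 2 ℝ _ _).symm.toContinuousLinearMap ∘L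
        ((β • WithLp.fstL 2 ℝ _ _ ∘L WithLp.sndL 2 ℝ _ _).prod
          (γ • WithLp.sndL 2 ℝ _ _ ∘L WithLp.sndL 2 ℝ _ _
            + κ • WithLp.fstL 2 ℝ _ _ ∘L WithLp.sndL 2 ℝ _ _))))

theorem triangular_apply (α β γ κ : ℝ) (h : Strain l) :
    triangular l α β γ κ h = WithLp.toLp 2 (α • h.fst,
      WithLp.toLp 2 (β • h.snd.fst, γ • h.snd.snd + κ • h.snd.fst)) := rfl

/-- The map `h ↦ A h` for which `‖A h‖²` is the integral of the relaxed forms with coefficients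
`c`, `g`, `k`. -/
def formMap (l c g k : ℝ) : Strain l →L[ℝ] Strain l :=
  triangular l (√c) (√(c / 12)) (√(g / 12)) (√(g / 12) * k)

/-- The diagonal entries are nonzero, so the map has a bounded left inverse that is again lower
triangular. -/
theorem exists_norm_le_formMap {c g : ℝ} (l k : ℝ) (hc : 0 < c) (hg : 0 < g) :
    ∃ K, 0 ≤ K ∧ ∀ h : Strain l, ‖h‖ ≤ K * ‖formMap l c g k h‖ := by
  have h1 : √c ≠ 0 := (Real.sqrt_pos.2 hc).ne'
  have h2 : √(c / 12) ≠ 0 := (Real.sqrt_pos.2 (by positivity)).ne'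
  have h3 : √(g / 12) ≠ 0 := (Real.sqrt_pos.2 (by positivity)).ne'
  set L := triangular l (√c)⁻¹ (√(c / 12))⁻¹ (√(g / 12))⁻¹ (-(k * (√(c / 12))⁻¹))
  refine ⟨‖L‖, norm_nonneg _, fun h => ?_⟩
  have : L (formMap l c g k h) = h := by
    rw [formMap, triangular_apply, triangular_apply]
    apply (WithLp.equiv 2 _).injective
    refine Prod.ext ?_ ((WithLp.equiv 2 _).injective (Prod.ext ?_ ?_))
    · change (√c)⁻¹ • (√c • h.fst) = h.fst
      rw [smul_smul, inv_mul_cancel₀ h1, one_smul]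
    · change (√(c / 12))⁻¹ • (√(c / 12) • h.snd.fst) = h.snd.fst
      rw [smul_smul, inv_mul_cancel₀ h2, one_smul]
    · change (√(g / 12))⁻¹ • (√(g / 12) • h.snd.snd + (√(g / 12) * k) • h.snd.fst)
        + (-(k * (√(c / 12))⁻¹)) • (√(c / 12) • h.snd.fst) = h.snd.snd
      rw [smul_add, smul_smul, smul_smul, smul_smul, inv_mul_cancel₀ h3, one_smul, ← mul_assoc,
        inv_mul_cancel₀ h3, neg_mul, mul_assoc, inv_mul_cancel₀ h2, one_mul, mul_one, neg_smul,
        add_neg_cancel_right]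
  calc ‖h‖ = ‖L (formMap l c g k h)‖ := by rw [this]
    _ ≤ _ := L.le_opNorm _

theorem norm_sq_eq_integral {α : Type*} [MeasurableSpace α] {μ : Measure α} (f : Lp ℝ 2 μ) :
    ‖f‖ ^ 2 = ∫ x, (f x) ^ 2 ∂μ := by
  rw [← real_inner_self_eq_norm_sq, L2.inner_def]
  refine integral_congr_ae (Eventually.of_forall fun x => ?_)
  simp [sq]

theorem norm_formMap_sq {Q : QuadraticForm ℝ (Matrix (Fin 2) (Fin 2) ℝ)} {c g k : ℝ} (hc : 0 ≤ c)
    (hg : 0 ≤ g) (h1 : ∀ p q, Q1 Q p q = g * (q + k * p) ^ 2 + c * p ^ 2)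
    (h0 : ∀ p, Q0 Q p = c * p ^ 2) (h : Strain l) :
    ‖formMap l c g k h‖ ^ 2 = (∫ x in S l, Q0 Q (h.fst x))
      + 1 / 12 * ∫ t in I l, Q1 Q (h.snd.fst t) (h.snd.snd t) := by
  rw [formMap, triangular_apply, WithLp.prod_norm_sq_eq_of_L2, WithLp.prod_norm_sq_eq_of_L2]
  change ‖√c • h.fst‖ ^ 2 + (‖√(c / 12) • h.snd.fst‖ ^ 2
    + ‖√(g / 12) • h.snd.snd + (√(g / 12) * k) • h.snd.fst‖ ^ 2) = _
  rw [mul_smul, ← smul_add, norm_smul, norm_smul, norm_smul, mul_pow, mul_pow, mul_pow,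
    Real.norm_eq_abs, Real.norm_eq_abs, Real.norm_eq_abs, sq_abs, sq_abs, sq_abs, Real.sq_sqrt hc,
    Real.sq_sqrt (by positivity), Real.sq_sqrt (by positivity), norm_sq_eq_integral,
    norm_sq_eq_integral, norm_sq_eq_integral]
  simp only [h0, h1]
  have i1 : Integrable (fun t => (h.snd.fst t) ^ 2) (volume.restrict (I l)) :=
    (Lp.memLp h.snd.fst).integrable_sq
  have i2 : Integrable (fun t => (h.snd.snd t + k * h.snd.fst t) ^ 2) (volume.restrict (I l)) :=
    ((Lp.memLp h.snd.snd).add ((Lp.memLp h.snd.fst).const_mul k)).integrable_sq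
  have e2 : ∫ t in I l, ((h.snd.snd + k • h.snd.fst : L2I l) t) ^ 2
      = ∫ t in I l, (h.snd.snd t + k * h.snd.fst t) ^ 2 := by
    refine integral_congr_ae ?_
    filter_upwards [Lp.coeFn_add h.snd.snd (k • h.snd.fst), Lp.coeFn_smul k h.snd.fst]
      with t ht1 ht2
    rw [ht1, Pi.add_apply, ht2, Pi.smul_apply, smul_eq_mul]
  rw [e2, integral_add (i2.const_mul _) (i1.const_mul _), integral_const_mul, integral_const_mul,
    integral_const_mul]
  ring

/-- The linear part of the strain. -/
def linearStrain (l : ℝ) : Ambient l →L[ℝ] Strain l :=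
  (WithLp.prodContinuousLinearEquiv 2 ℝ _ _).symm.toContinuousLinearMap ∘L
    (((PiLp.proj 2 (fun _ : Fin 2 × Fin 3 => L2S l) (0, 1)) ∘L (SobolevS l).subtypeL ∘L
        WithLp.fstL 1 ℝ _ _).prod
      ((WithLp.prodContinuousLinearEquiv 2 ℝ _ _).symm.toContinuousLinearMap ∘L
        (((PiLp.proj 2 (fun _ : Fin 3 => L2I l) 2) ∘L (SobolevI l 2).subtypeL ∘L
            WithLp.fstL 1 ℝ _ _ ∘L WithLp.sndL 1 ℝ _ _).prod
          ((PiLp.proj 2 (fun _ : Fin 2 => L2I l) 1) ∘L (SobolevI l 1).subtypeL ∘L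
            WithLp.sndL 1 ℝ _ _ ∘L WithLp.sndL 1 ℝ _ _))))

/-- A membrane strain as an element of the space of strains. -/
def membrane (f : L2S l) : Strain l := WithLp.toLp 2 (f, 0)

theorem norm_membrane (f : L2S l) : ‖membrane f‖ = ‖f‖ :=
  WithLp.norm_toLp_fst 2 _ _ f

theorem membrane_add (f g : L2S l) : membrane (f + g) = membrane f + membrane g := by
  unfold membrane
  rw [← WithLp.toLp_add, Prod.mk_add_mk, add_zero]

theorem membrane_smul (r : ℝ) (f : L2S l) : membrane (r • f) = r • membrane f := by
  unfold membrane
  rw [← WithLp.toLp_smul, Prod.smul_mk, smul_zero]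

/-- The strain `(∂₁y₁ + |w'|²/2, w'', θ')`. -/
def strain (u : Ambient l) : Strain l :=
  linearStrain l u + membrane ((1 / 2 : ℝ) • mulLift (u.w.1 1) (u.w.1 1))

/-- Ensures that products with `w'` are in `L²`, so that `mulLift` never takes its default value in
the strain. -/
theorem essBounded_deriv (hl : 0 < l) (w : SobolevI l 2) : EssBounded (w.1 1) :=
  HasWeakDeriv.essBounded hl (w.2 1)

theorem strain_fst_ae (hl : 0 < l) (u : Ambient l) : (strain u).fst =ᵐ[volume.restrict (S l)]
    fun x => u.y.1 (0, 1) x + (u.w.1 1 x.1) ^ 2 / 2 := by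
  have e : (strain u).fst = u.y.1 (0, 1) + (1 / 2 : ℝ) • mulLift (u.w.1 1) (u.w.1 1) := rfl
  rw [e]
  filter_upwards [Lp.coeFn_add (u.y.1 (0, 1)) ((1 / 2 : ℝ) • mulLift (u.w.1 1) (u.w.1 1)),
    Lp.coeFn_smul (1 / 2 : ℝ) (mulLift (u.w.1 1) (u.w.1 1)),
    (essBounded_deriv hl u.w).coeFn_mulLift (u.w.1 1)] with x h1 h2 h3
  rw [h1, Pi.add_apply, h2, Pi.smul_apply, h3, smul_eq_mul]
  ring

theorem strain_snd_fst (u : Ambient l) : (strain u).snd.fst = u.w.1 2 := by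
  change u.w.1 2 + 0 = _
  rw [add_zero]

theorem strain_snd_snd (u : Ambient l) : (strain u).snd.snd = u.θ.1 1 := by
  change u.θ.1 1 + 0 = _
  rw [add_zero]

variable {Q : QuadraticForm ℝ (Matrix (Fin 2) (Fin 2) ℝ)} {c g k : ℝ}

theorem energy_eq (hl : 0 < l) (hc : 0 ≤ c) (hg : 0 ≤ g)
    (h1 : ∀ p q, Q1 Q p q = g * (q + k * p) ^ 2 + c * p ^ 2)
    (h0 : ∀ p, Q0 Q p = c * p ^ 2) (u : Ambient l) :
    energy Q u = 1 / 2 * ‖formMap l c g k (strain u)‖ ^ 2 := by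
  rw [norm_formMap_sq hc hg h1 h0, strain_snd_fst, strain_snd_snd, energy]
  have : ∫ x in S l, Q0 Q ((strain u).fst x)
      = ∫ x in S l, Q0 Q (u.y.1 (0, 1) x + (u.w.1 1 x.1) ^ 2 / 2) := by
    refine integral_congr_ae ?_
    filter_upwards [strain_fst_ae hl u] with x hx
    rw [hx]
  rw [this]
  ring

theorem dissip_eq (hl : 0 < l) (hc : 0 ≤ c) (hg : 0 ≤ g)
    (h1 : ∀ p q, Q1 Q p q = g * (q + k * p) ^ 2 + c * p ^ 2)
    (h0 : ∀ p, Q0 Q p = c * p ^ 2) (u v : Ambient l) :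
    dissip Q u v = ‖formMap l c g k (strain u) - formMap l c g k (strain v)‖ := by
  rw [← map_sub, ← Real.sqrt_sq (norm_nonneg _), norm_formMap_sq hc hg h1 h0, dissip]
  have e1 : (strain u - strain v).fst = (strain u).fst - (strain v).fst := rfl
  have e2 : (strain u - strain v).snd.fst = u.w.1 2 - v.w.1 2 := by
    rw [← strain_snd_fst, ← strain_snd_fst]; rfl
  have e3 : (strain u - strain v).snd.snd = u.θ.1 1 - v.θ.1 1 := by
    rw [← strain_snd_snd, ← strain_snd_snd]; rfl
  rw [e1, e2, e3]
  congr 2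
  · refine integral_congr_ae ?_
    filter_upwards [strain_fst_ae hl u, strain_fst_ae hl v,
      Lp.coeFn_sub (strain u).fst (strain v).fst] with x hx hy hxy
    rw [hxy, Pi.sub_apply, hx, hy]
    congr 1
    ring
  · congr 1
    refine integral_congr_ae ?_
    filter_upwards [Lp.coeFn_sub (u.w.1 2) (v.w.1 2), Lp.coeFn_sub (u.θ.1 1) (v.θ.1 1)]
      with x hx hy
    rw [hx, hy, Pi.sub_apply, Pi.sub_apply]

theorem norm_bending_sub_le (u v : Ambient l) : ‖u.w.1 2 - v.w.1 2‖ ≤ ‖strain u - strain v‖ := by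
  have e : (strain u - strain v).snd.fst = u.w.1 2 - v.w.1 2 := by
    rw [← strain_snd_fst, ← strain_snd_fst]; rfl
  rw [← e]
  exact (WithLp.norm_fst_le _ _).trans (WithLp.norm_snd_le _ _)

/-- The second order expansion of the strain. -/
theorem strain_add_smul (hl : 0 < l) (u δ : Ambient l) (s : ℝ) :
    strain (u + s • δ) = strain u + s • (linearStrain l δ + membrane (mulLift (u.w.1 1) (δ.w.1 1)))
      + s ^ 2 • membrane ((1 / 2 : ℝ) • mulLift (δ.w.1 1) (δ.w.1 1)) := by
  have hP := mulLift_add_smul_self (essBounded_deriv hl u.w) (essBounded_deriv hl δ.w)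
    (essBounded_deriv hl (u + s • δ).w) (s := s) rfl
  rw [strain, strain, map_add, map_smul, hP]
  simp only [membrane_add, membrane_smul, smul_add]
  module

end StrainMap

/-! ### The affine structure of the set of admissible states -/

section ZeroTrace

theorem HasZeroTrace.congr {V : Type*} [NormedAddCommGroup V] [NormedSpace ℝ V]
    [MeasureSpace V] {Ω : Set V} {e : V} {f f' g g' : V → ℝ} (h : HasZeroTrace Ω e f f')
    (hf : g =ᵐ[volume.restrict Ω] f) (hf' : g' =ᵐ[volume.restrict Ω] f') :
    HasZeroTrace Ω e g g' := by
  intro φ hφ hc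
  rw [← h φ hφ hc]
  refine integral_congr_ae ?_
  filter_upwards [hf, hf'] with x hx hx'
  rw [hx, hx']

theorem coeFn_add_smul_sub {V : Type*} [MeasurableSpace V] {μ : Measure V} (f g h : Lp ℝ 2 μ) (c : ℝ) :
    (f + c • (g - h) : Lp ℝ 2 μ) =ᵐ[μ] fun x => f x + c * (g x - h x) := by
  filter_upwards [Lp.coeFn_add f (c • (g - h)), Lp.coeFn_smul c (g - h), Lp.coeFn_sub g h]
    with x h1 h2 h3
  rw [h1, Pi.add_apply, h2, Pi.smul_apply, h3, Pi.sub_apply, smul_eq_mul]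

variable {V : Type*} [NormedAddCommGroup V] [NormedSpace ℝ V] [MeasureSpace V] [BorelSpace V]
  [IsFiniteMeasureOnCompacts (volume : Measure V)] {Ω : Set V} {e : V}

theorem HasZeroTrace.add_const_mul {f f' g g' : V → ℝ} (hf : MemLp f 2 (volume.restrict Ω))
    (hf' : MemLp f' 2 (volume.restrict Ω)) (hg : MemLp g 2 (volume.restrict Ω))
    (hg' : MemLp g' 2 (volume.restrict Ω)) (h₁ : HasZeroTrace Ω e f f')
    (h₂ : HasZeroTrace Ω e g g') (c : ℝ) :
    HasZeroTrace Ω e (fun x => f x + c * g x) (fun x => f' x + c * g' x) := by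
  intro φ hφ hc
  have hi : ∀ {f f' : V → ℝ}, MemLp f 2 (volume.restrict Ω) → MemLp f' 2 (volume.restrict Ω) →
      Integrable (fun x => f x * fderiv ℝ φ x e + f' x * φ x) (volume.restrict Ω) :=
    fun hf hf' => (hf.integrable_mul (q := 2) (((continuous_dirDeriv hφ).memLp_of_hasCompactSupport
      (hasCompactSupport_dirDeriv hc)).restrict Ω)).add
      (hf'.integrable_mul (q := 2) ((hφ.continuous.memLp_of_hasCompactSupport hc).restrict Ω))
  calc _ = ∫ x in Ω, ((f x * fderiv ℝ φ x e + f' x * φ x)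
        + c * (g x * fderiv ℝ φ x e + g' x * φ x)) := by
        refine integral_congr_ae (Eventually.of_forall fun x => ?_)
        simp only
        ring
    _ = 0 := by
        rw [integral_add (hi hf hf') ((hi hg hg').const_mul c), integral_const_mul, h₁ φ hφ hc,
          h₂ φ hφ hc]
        simp

theorem HasZeroTrace.sub {f f' g g' : V → ℝ} (hf : MemLp f 2 (volume.restrict Ω))
    (hf' : MemLp f' 2 (volume.restrict Ω)) (hg : MemLp g 2 (volume.restrict Ω))
    (hg' : MemLp g' 2 (volume.restrict Ω)) (h₁ : HasZeroTrace Ω e f f')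
    (h₂ : HasZeroTrace Ω e g g') :
    HasZeroTrace Ω e (fun x => f x - g x) (fun x => f' x - g' x) := by
  convert h₁.add_const_mul hf hf' hg hg' h₂ (-1) using 2 <;> ring

/-- The boundary condition "`f = b` on the boundary" is affine. -/
theorem HasZeroTrace.add_smul_sub {f f' g g' h h' : Lp ℝ 2 (volume.restrict Ω)} {b b' : V → ℝ}
    (hb : MemLp b 2 (volume.restrict Ω)) (hb' : MemLp b' 2 (volume.restrict Ω))
    (hf : HasZeroTrace Ω e (fun x => f x - b x) (fun x => f' x - b' x))
    (hg : HasZeroTrace Ω e (fun x => g x - b x) (fun x => g' x - b' x))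
    (hh : HasZeroTrace Ω e (fun x => h x - b x) (fun x => h' x - b' x)) (c : ℝ) :
    HasZeroTrace Ω e (fun x => (f + c • (g - h) : Lp ℝ 2 (volume.restrict Ω)) x - b x)
      (fun x => (f' + c • (g' - h') : Lp ℝ 2 (volume.restrict Ω)) x - b' x) := by
  have hm : ∀ (f : Lp ℝ 2 (volume.restrict Ω)) {b : V → ℝ}, MemLp b 2 (volume.restrict Ω) →
      MemLp (fun x => f x - b x) 2 (volume.restrict Ω) := fun f _ hb => (Lp.memLp f).sub hb
  refine ((hf.add_const_mul (hm f hb) (hm f' hb') ((hm g hb).sub (hm h hb))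
    ((hm g' hb').sub (hm h' hb')) (hg.sub (hm g hb) (hm g' hb') (hm h hb) (hm h' hb') hh) c)).congr
    ?_ ?_
  · filter_upwards [coeFn_add_smul_sub f g h c] with x hx
    rw [hx]
    simp only [Pi.sub_apply]
    ring
  · filter_upwards [coeFn_add_smul_sub f' g' h' c] with x hx
    rw [hx]
    simp only [Pi.sub_apply]
    ring

end ZeroTrace

section S1D

variable {l : ℝ} {uhat₁ : SobolevI l 1} {uhat₂ vhat : SobolevI l 2}

theorem memLp_snd_mul_lift (f : L2I l) :
    MemLp (fun x : ℝ × ℝ => x.2 * f x.1) 2 (volume.restrict (S l)) := by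
  have hm : MeasurableSet (S l) := measurableSet_Ioo.prod measurableSet_Ioo
  refine (memLp_lift f).of_le_mul (c := 1 / 2)
    (measurable_snd.aestronglyMeasurable.mul (memLp_lift f).aestronglyMeasurable) ?_
  filter_upwards [ae_restrict_mem hm] with x hx
  rw [norm_mul]
  refine mul_le_mul_of_nonneg_right ?_ (norm_nonneg _)
  exact abs_le.2 ⟨hx.2.1.le, hx.2.2.le⟩

theorem HasBoundaryValues.add_smul_sub {k : ℕ} {u v w b : SobolevI l k}
    (hu : HasBoundaryValues u b) (hv : HasBoundaryValues v b) (hw : HasBoundaryValues w b) (c : ℝ) :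
    HasBoundaryValues (u + c • (v - w)) b := fun j =>
  (hu j).add_smul_sub (Lp.memLp _) (Lp.memLp _) (hv j) (hw j) c

theorem IsBernoulliNavier.add_smul_sub {u v w : SobolevS l}
    (hu : IsBernoulliNavier uhat₁ uhat₂ u) (hv : IsBernoulliNavier uhat₁ uhat₂ v)
    (hw : IsBernoulliNavier uhat₁ uhat₂ w) (c : ℝ) :
    IsBernoulliNavier uhat₁ uhat₂ (u + c • (v - w)) := by
  refine ⟨?_, ?_, ?_, ?_⟩
  · filter_upwards [hu.1, hv.1, hw.1, coeFn_add_smul_sub (u.1 (0, 2)) (v.1 (0, 2)) (w.1 (0, 2)) c,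
      coeFn_add_smul_sub (u.1 (1, 1)) (v.1 (1, 1)) (w.1 (1, 1)) c] with x h1 h2 h3 h4 h5
    change ((u.1 (0, 2) + c • (v.1 (0, 2) - w.1 (0, 2)) : L2S l) x
      + (u.1 (1, 1) + c • (v.1 (1, 1) - w.1 (1, 1)) : L2S l) x) / 2 = 0
    rw [h4, h5]
    linear_combination h1 + c * (h2 - h3)
  · filter_upwards [hu.2.1, hv.2.1, hw.2.1,
      coeFn_add_smul_sub (u.1 (1, 2)) (v.1 (1, 2)) (w.1 (1, 2)) c] with x h1 h2 h3 h4
    change (u.1 (1, 2) + c • (v.1 (1, 2) - w.1 (1, 2)) : L2S l) x = 0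
    rw [h4, h1, h2, h3]
    ring
  · exact hu.2.2.1.add_smul_sub ((memLp_lift _).sub (memLp_snd_mul_lift _))
      ((memLp_lift _).sub (memLp_snd_mul_lift _)) hv.2.2.1 hw.2.2.1 c
  · exact hu.2.2.2.add_smul_sub (memLp_lift _) (memLp_lift _) hv.2.2.2 hw.2.2.2 c

/-- Used with `w = u` for segments, and with `c = 1` for recovery sequences `z + (v - u)`. -/
theorem S1D_add_smul_sub {u v w : Ambient l} (hu : u ∈ S1D uhat₁ uhat₂ vhat)
    (hv : v ∈ S1D uhat₁ uhat₂ vhat) (hw : w ∈ S1D uhat₁ uhat₂ vhat) (c : ℝ) :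
    u + c • (v - w) ∈ S1D uhat₁ uhat₂ vhat :=
  ⟨hu.1.add_smul_sub hv.1 hw.1 c, hu.2.1.add_smul_sub hv.2.1 hw.2.1 c,
    hu.2.2.add_smul_sub hv.2.2 hw.2.2 c⟩

/-! ### Poincaré estimates and almost convexity of the strain -/

theorem hasZeroTrace_deriv_sub {u v : Ambient l} (hu : u ∈ S1D uhat₁ uhat₂ vhat)
    (hv : v ∈ S1D uhat₁ uhat₂ vhat) : HasZeroTrace (I l) 1 ((u - v).w.1 1) ((u - v).w.1 2) := by
  have h := HasZeroTrace.sub ((Lp.memLp _).sub (Lp.memLp _)) ((Lp.memLp _).sub (Lp.memLp _))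
    ((Lp.memLp _).sub (Lp.memLp _)) ((Lp.memLp _).sub (Lp.memLp _)) (hu.2.1 1) (hv.2.1 1)
  refine h.congr ?_ ?_
  · filter_upwards [Lp.coeFn_sub (u.w.1 1) (v.w.1 1)] with x hx
    refine hx.trans ?_
    change u.w.1 1 x - v.w.1 1 x = (u.w.1 1 x - vhat.1 1 x) - (v.w.1 1 x - vhat.1 1 x)
    ring
  · filter_upwards [Lp.coeFn_sub (u.w.1 2) (v.w.1 2)] with x hx
    refine hx.trans ?_
    change u.w.1 2 x - v.w.1 2 x = (u.w.1 2 x - vhat.1 2 x) - (v.w.1 2 x - vhat.1 2 x)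
    ring

theorem norm_deriv_sub_le (hl : 0 < l) {u v : Ambient l} (hu : u ∈ S1D uhat₁ uhat₂ vhat)
    (hv : v ∈ S1D uhat₁ uhat₂ vhat) : ‖(u - v).w.1 1‖ ≤ l * ‖(u - v).w.1 2‖ := by
  have hfin : IsFiniteMeasure (volume.restrict (I l)) := ⟨by simp [I]⟩
  have h := Lp.norm_le_of_ae_bound (f := (u - v).w.1 1) (C := √l * ‖(u - v).w.1 2‖) (by positivity)
    ((hasZeroTrace_deriv_sub hu hv).ae_abs_le hl)
  refine h.trans (le_of_eq ?_)
  have hm : (measureUnivNNReal (volume.restrict (I l)) : ℝ) = l := by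
    simp [measureUnivNNReal, I, Real.coe_toNNReal _ hl.le, ENNReal.ofReal]
  rw [hm, ENNReal.toReal_ofNat, ← one_div, ← Real.sqrt_eq_rpow, ← mul_assoc,
    Real.mul_self_sqrt hl.le]

/-- One factor is estimated in the sup norm, the other in `L²`, both by the bending strain. -/
theorem norm_mulLift_deriv_sub_le (hl : 0 < l) {u v : Ambient l} (hu : u ∈ S1D uhat₁ uhat₂ vhat)
    (hv : v ∈ S1D uhat₁ uhat₂ vhat) :
    ‖mulLift ((u - v).w.1 1) ((u - v).w.1 1)‖ ≤ √l * l * ‖strain u - strain v‖ ^ 2 := by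
  have h2 : ‖(u - v).w.1 2‖ ≤ ‖strain u - strain v‖ := norm_bending_sub_le u v
  calc _ ≤ √l * ‖(u - v).w.1 2‖ * ‖(u - v).w.1 1‖ :=
        norm_mulLift_le ((hasZeroTrace_deriv_sub hu hv).ae_abs_le hl) _
    _ ≤ √l * ‖(u - v).w.1 2‖ * (l * ‖(u - v).w.1 2‖) := by
        gcongr; exact norm_deriv_sub_le hl hu hv
    _ ≤ √l * ‖strain u - strain v‖ * (l * ‖strain u - strain v‖) := by gcongr
    _ = _ := by ring

/-- `1 / 2` times the squared difference of the slopes, the defect of convexity of the strain. -/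
def defect (δ : Ambient l) : Strain l := membrane ((1 / 2 : ℝ) • mulLift (δ.w.1 1) (δ.w.1 1))

/-- Eliminating the linear term of the second order expansion through its case `s = 1` leaves `(s² -
s)` times the defect. -/
theorem strain_segment (hl : 0 < l) (u v : Ambient l) (s : ℝ) :
    strain (u + s • (v - u)) = strain u + s • (strain v - strain u)
      - (s * (1 - s)) • defect (v - u) := by
  have h1 := strain_add_smul hl u (v - u) s
  have h2 := strain_add_smul hl u (v - u) 1
  rw [one_smul, add_sub_cancel, one_smul, one_pow, one_smul] at h2
  rw [h1, h2, defect]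
  module

theorem exists_isAlmostConvex (hl : 0 < l) (A B : Strain l →L[ℝ] Strain l) {L : ℝ} (hL : 0 ≤ L)
    (hB : ∀ h, ‖h‖ ≤ L * ‖B h‖) : ∃ K, 0 < K ∧ ∀ (uhat₁ : SobolevI l 1) (uhat₂ vhat : SobolevI l 2),
      IsAlmostConvex (fun u : S1D uhat₁ uhat₂ vhat => A (strain u.1))
        (fun u : S1D uhat₁ uhat₂ vhat => B (strain u.1)) K := by
  set c := √l * l * L ^ 2
  have hc : 0 ≤ c := by positivity
  -- The summands serve, in order, `1 ≤ K`, the Lipschitz bound, and the images of the defect under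
  -- `A` and `B`.
  refine ⟨1 + ‖A‖ * L + (‖A‖ + ‖B‖) * c, by positivity, fun uhat₁ uhat₂ vhat => ⟨?_, ?_, ?_⟩⟩
  · have : 0 ≤ ‖A‖ * L + (‖A‖ + ‖B‖) * c := by positivity
    linarith
  · intro u v
    rw [← map_sub, ← map_sub]
    calc _ ≤ ‖A‖ * ‖strain u.1 - strain v.1‖ := A.le_opNorm _
      _ ≤ ‖A‖ * (L * ‖B (strain u.1 - strain v.1)‖) := by gcongr; exact hB _
      _ = (‖A‖ * L) * ‖B (strain u.1 - strain v.1)‖ := by ring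
      _ ≤ _ := by
        gcongr
        have : 0 ≤ (‖A‖ + ‖B‖) * c := by positivity
        linarith
  · intro u v
    have hd : ‖defect (v.1 - u.1)‖ ≤ c * ‖B (strain u.1) - B (strain v.1)‖ ^ 2 := by
      rw [defect, norm_membrane, norm_smul, ← map_sub]
      have h1 := norm_mulLift_deriv_sub_le hl v.2 u.2
      have h2 : ‖strain v.1 - strain u.1‖ ≤ L * ‖B (strain u.1 - strain v.1)‖ := by
        rw [norm_sub_rev]; exact hB _
      calc _ ≤ 1 * (√l * l * ‖strain v.1 - strain u.1‖ ^ 2) := by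
            gcongr; norm_num
        _ ≤ 1 * (√l * l * (L * ‖B (strain u.1 - strain v.1)‖) ^ 2) := by gcongr
        _ = _ := by ring
    have h0 : 0 ≤ ‖A‖ * L := by positivity
    have hle : ∀ M : Strain l →L[ℝ] Strain l, ‖M‖ ≤ ‖A‖ + ‖B‖ → ‖M (defect (v.1 - u.1))‖
        ≤ (1 + ‖A‖ * L + (‖A‖ + ‖B‖) * c) * ‖B (strain u.1) - B (strain v.1)‖ ^ 2 := by
      intro M hM
      calc _ ≤ ‖M‖ * ‖defect (v.1 - u.1)‖ := M.le_opNorm _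
        _ ≤ (‖A‖ + ‖B‖) * (c * ‖B (strain u.1) - B (strain v.1)‖ ^ 2) := by gcongr
        _ = ((‖A‖ + ‖B‖) * c) * ‖B (strain u.1) - B (strain v.1)‖ ^ 2 := by ring
        _ ≤ _ := by gcongr; linarith
    refine ⟨A (defect (v.1 - u.1)), B (defect (v.1 - u.1)),
      hle A (by linarith [norm_nonneg B]), hle B (by linarith [norm_nonneg A]), fun s _ =>
      ⟨⟨u.1 + s • (v.1 - u.1), S1D_add_smul_sub u.2 v.2 u.2 s⟩, ?_, ?_⟩⟩
    · simp only [strain_segment hl, map_sub, map_add, map_smul]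
    · simp only [strain_segment hl, map_sub, map_add, map_smul]

/-- The energy and the dissipation distance are Hilbert norms of the strain, and they are almost
convex along segments, with a constant that does not depend on the boundary data. -/
theorem exists_hilbert_model (hl : 0 < l) {QW QR : QuadraticForm ℝ (Matrix (Fin 2) (Fin 2) ℝ)}
    (hW : IsAdmissibleForm QW) (hR : IsAdmissibleForm QR) :
    ∃ (A B : Strain l →L[ℝ] Strain l) (K L : ℝ), 0 < K ∧ (∀ h, ‖h‖ ≤ L * ‖B h‖) ∧
      (∀ u : Ambient l, energy QW u = 1 / 2 * ‖A (strain u)‖ ^ 2) ∧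
      (∀ u v : Ambient l, dissip QR u v = ‖B (strain u) - B (strain v)‖) ∧
      ∀ (uhat₁ : SobolevI l 1) (uhat₂ vhat : SobolevI l 2),
        IsAlmostConvex (fun u : S1D uhat₁ uhat₂ vhat => A (strain u.1))
          (fun u : S1D uhat₁ uhat₂ vhat => B (strain u.1)) K := by
  obtain ⟨cW, gW, kW, hcW, hgW, hW1, hW0⟩ := hW.exists_coefficients
  obtain ⟨cR, gR, kR, hcR, hgR, hR1, hR0⟩ := hR.exists_coefficients
  obtain ⟨L, hL, hB⟩ := exists_norm_le_formMap l kR hcR hgR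
  obtain ⟨K, hK, hconv⟩ := exists_isAlmostConvex hl (formMap l cW gW kW) (formMap l cR gR kR) hL hB
  exact ⟨_, _, K, L, hK, hB, energy_eq hl hcW.le hgW.le hW1 hW0,
    dissip_eq hl hcR.le hgR.le hR1 hR0, hconv⟩

end S1D

/-! ### Lower semicontinuity of the slope -/

section Hilbert

variable {H : Type*} [NormedAddCommGroup H] [InnerProductSpace ℝ H]

theorem tendsto_inner_of_weak_of_strong {ι : Type*} {F : Filter ι} {x d : ι → H} {x₀ d₀ : H} {N : ℝ}
    (hN : ∀ᶠ i in F, ‖x i‖ ≤ N) (hx : ∀ h, Tendsto (fun i => inner ℝ (x i) h) F (𝓝 (inner ℝ x₀ h)))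
    (hd : Tendsto d F (𝓝 d₀)) :
    Tendsto (fun i => inner ℝ (x i) (d i)) F (𝓝 (inner ℝ x₀ d₀)) := by
  have h1 : Tendsto (fun i => inner ℝ (x i) (d i - d₀)) F (𝓝 0) := by
    have h2 : Tendsto (fun i => N * ‖d i - d₀‖) F (𝓝 0) := by
      simpa using (tendsto_iff_norm_sub_tendsto_zero.1 hd).const_mul N
    refine squeeze_zero_norm' ?_ h2
    filter_upwards [hN] with i hi
    exact (norm_inner_le_norm _ _).trans (mul_le_mul_of_nonneg_right hi (norm_nonneg _))
  have h3 := h1.add (hx d₀)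
  rw [zero_add] at h3
  refine h3.congr fun i => ?_
  rw [inner_sub_right, sub_add_cancel]

theorem tendsto_inner_of_eq_add {ι : Type*} {F : Filter ι} {x₀ : H} {x d r : ι → H}
    (hx : ∀ i, x i = x₀ + d i + r i) (hd : ∀ h, Tendsto (fun i => inner ℝ h (d i)) F (𝓝 0))
    (hr : Tendsto r F (𝓝 0)) (h : H) :
    Tendsto (fun i => inner ℝ (x i) h) F (𝓝 (inner ℝ x₀ h)) := by
  have h2 : Tendsto (fun i => inner ℝ (r i) h) F (𝓝 0) := by
    simpa using hr.inner (𝕜 := ℝ) (tendsto_const_nhds (x := h))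
  have h3 := ((hd h).const_add (inner ℝ x₀ h)).add h2
  rw [add_zero, add_zero] at h3
  refine h3.congr fun i => ?_
  rw [hx, inner_add_left, inner_add_left, real_inner_comm h (d i)]

theorem exists_norm_le_of_weak [CompleteSpace H] {x : ℕ → H} {x₀ : H}
    (hx : ∀ h, Tendsto (fun i => inner ℝ (x i) h) atTop (𝓝 (inner ℝ x₀ h))) :
    ∃ N, ∀ i, ‖x i‖ ≤ N := by
  obtain ⟨N, hN⟩ := banach_steinhaus (g := fun i => innerSL ℝ (x i)) fun h => by
    obtain ⟨C, hC⟩ := (hx h).norm.bddAbove_range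
    exact ⟨C, fun i => hC (mem_range_self i)⟩
  exact ⟨N, fun i => by simpa using hN i⟩

end Hilbert

section S1D

variable {l : ℝ} {uhat₁ : SobolevI l 1} {uhat₂ vhat : SobolevI l 2}

/-- Expanding about `z` and about `u` with the same increment `v - u`, only the mixed term differs.
It carries the factor `z' - u'` of the out-of-plane slopes, small in `L²`, against a fixed bounded
function. -/
theorem strain_recovery (hl : 0 < l) (u v z : Ambient l) :
    strain (z + (1 : ℝ) • (v - u)) = strain z + (strain v - strain u)
      + membrane (mulLift ((v - u).w.1 1) ((z - u).w.1 1)) := by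
  have h1 := strain_add_smul hl z (v - u) 1
  have h2 := strain_add_smul hl u (v - u) 1
  rw [one_smul ℝ (v - u), add_sub_cancel] at h2
  have h3 : membrane (mulLift ((v - u).w.1 1) ((z - u).w.1 1))
      = membrane (mulLift (z.w.1 1) ((v - u).w.1 1)) - membrane (mulLift (u.w.1 1) ((v - u).w.1 1)) := by
    rw [mulLift_comm, ← mulLift_sub_left (essBounded_deriv hl z.w) (essBounded_deriv hl u.w)
      (essBounded_deriv hl (z - u).w) rfl, sub_eq_add_neg, ← neg_one_smul ℝ, membrane_add,
      membrane_smul, neg_one_smul, ← sub_eq_add_neg]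
  rw [h1, h2, h3]
  module

/-- The recovery family is `z i + (v - u)`: its strain increments converge strongly, so the energy
differences converge as pairings of weakly with strongly convergent families. -/
theorem localSlope_le_liminf_of_tendsto (hl : 0 < l) {A B : Strain l →L[ℝ] Strain l} {K : ℝ}
    (hK : IsAlmostConvex (fun u : S1D uhat₁ uhat₂ vhat => A (strain u.1))
      (fun u : S1D uhat₁ uhat₂ vhat => B (strain u.1)) K) {ι : Type*} {F : Filter ι} [F.NeBot]
    {z : ι → S1D uhat₁ uhat₂ vhat} {u : S1D uhat₁ uhat₂ vhat} {N : ℝ}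
    (hN : ∀ᶠ i in F, ‖strain (z i).1‖ ≤ N)
    (hw : ∀ h, Tendsto (fun i => inner ℝ (strain (z i).1) h) F (𝓝 (inner ℝ (strain u.1) h)))
    (hs : Tendsto (fun i => ‖((z i).1 - u.1).w.1 1‖) F (𝓝 0)) :
    localSlope (fun u v : S1D uhat₁ uhat₂ vhat => ‖B (strain u.1) - B (strain v.1)‖)
        (fun u => 1 / 2 * ‖A (strain u.1)‖ ^ 2) u ≤
      liminf (fun i => localSlope
        (fun u v : S1D uhat₁ uhat₂ vhat => ‖B (strain u.1) - B (strain v.1)‖)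
        (fun u => 1 / 2 * ‖A (strain u.1)‖ ^ 2) (z i)) F := by
  have hbd : ∀ᶠ i in F, ‖A (strain (z i).1)‖ ≤ ‖A‖ * N := by
    filter_upwards [hN] with i hi
    exact (A.le_opNorm _).trans (by gcongr)
  have hAw : ∀ h, Tendsto (fun i => inner ℝ (A (strain (z i).1)) h) F
      (𝓝 (inner ℝ (A (strain u.1)) h)) := fun h => by
    simp only [← ContinuousLinearMap.adjoint_inner_right]
    exact hw _
  refine hK.localSlope_le_liminf (M := 1 / 2 * (‖A‖ * N) ^ 2) ?_ fun v => ?_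
  · filter_upwards [hbd] with i hi
    gcongr
  have hv' : ∀ i, (z i).1 + (1 : ℝ) • (v.1 - u.1) ∈ S1D uhat₁ uhat₂ vhat := fun i =>
    S1D_add_smul_sub (z i).2 v.2 u.2 1
  refine ⟨fun i => ⟨_, hv' i⟩, ?_⟩
  have hd : Tendsto (fun i => strain ((z i).1 + (1 : ℝ) • (v.1 - u.1)) - strain (z i).1) F
      (𝓝 (strain v.1 - strain u.1)) := by
    obtain ⟨C, hC⟩ := essBounded_deriv hl (v.1 - u.1).w
    have h0 : Tendsto (fun i => membrane (mulLift ((v.1 - u.1).w.1 1) (((z i).1 - u.1).w.1 1))) F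
        (𝓝 0) := by
      refine squeeze_zero_norm (fun i => ?_) (by simpa using hs.const_mul C)
      rw [norm_membrane]
      exact norm_mulLift_le hC _
    have h1 := (tendsto_const_nhds (x := strain v.1 - strain u.1)).add h0
    rw [add_zero] at h1
    refine h1.congr fun i => ?_
    rw [strain_recovery hl]
    abel
  have hAd := (A.continuous.tendsto _).comp hd
  have hBd := ((B.continuous.tendsto _).comp hd).norm
  constructor
  · have e : ∀ x y : Strain l, 1 / 2 * ‖A x‖ ^ 2 - 1 / 2 * ‖A y‖ ^ 2
        = -inner ℝ (A x) (A (y - x)) - 1 / 2 * ‖A (y - x)‖ ^ 2 := fun x y => by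
      rw [half_norm_sq_sub, ← map_sub, ← neg_sub y x, map_neg, inner_neg_left, norm_neg,
        real_inner_comm]
    simp only [e]
    exact (tendsto_inner_of_weak_of_strong hbd hAw hAd).neg.sub ((hAd.norm.pow 2).const_mul _)
  · have e : ∀ x y : Strain l, ‖B x - B y‖ = ‖B (y - x)‖ := fun x y => by
      rw [norm_sub_rev, map_sub]
    simp only [e]
    exact hBd

theorem localSlope_le_liminf_of_strong (hl : 0 < l) {A B : Strain l →L[ℝ] Strain l} {K L : ℝ}
    (hB : ∀ h, ‖h‖ ≤ L * ‖B h‖) (hK : IsAlmostConvex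
      (fun u : S1D uhat₁ uhat₂ vhat => A (strain u.1))
      (fun u : S1D uhat₁ uhat₂ vhat => B (strain u.1)) K) {ι : Type*} {F : Filter ι} [F.NeBot]
    {z : ι → S1D uhat₁ uhat₂ vhat} {u : S1D uhat₁ uhat₂ vhat}
    (hz : Tendsto (fun i => ‖B (strain u.1) - B (strain (z i).1)‖) F (𝓝 0)) :
    localSlope (fun u v : S1D uhat₁ uhat₂ vhat => ‖B (strain u.1) - B (strain v.1)‖)
        (fun u => 1 / 2 * ‖A (strain u.1)‖ ^ 2) u ≤
      liminf (fun i => localSlope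
        (fun u v : S1D uhat₁ uhat₂ vhat => ‖B (strain u.1) - B (strain v.1)‖)
        (fun u => 1 / 2 * ‖A (strain u.1)‖ ^ 2) (z i)) F := by
  have h0 : Tendsto (fun i => ‖strain (z i).1 - strain u.1‖) F (𝓝 0) := by
    refine squeeze_zero (fun _ => norm_nonneg _) (fun i => ?_) (by simpa using hz.const_mul L)
    rw [norm_sub_rev, ← map_sub]
    exact hB _
  have hlim : Tendsto (fun i => strain (z i).1) F (𝓝 (strain u.1)) :=
    tendsto_iff_norm_sub_tendsto_zero.2 h0
  refine localSlope_le_liminf_of_tendsto hl hK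
    (hlim.norm.eventually_le_const (lt_add_one ‖strain u.1‖))
    (fun h => hlim.inner tendsto_const_nhds) ?_
  refine squeeze_zero (fun _ => norm_nonneg _) (fun i => ?_) (by simpa using h0.const_mul l)
  exact (norm_deriv_sub_le hl (z i).2 u.2).trans
    (mul_le_mul_of_nonneg_left (norm_bending_sub_le _ _) hl.le)

/-- Weakly convergent second derivatives and zero traces give strong convergence. -/
theorem tendsto_norm_of_hasZeroTrace (hl : 0 < l) {f f' : ℕ → L2I l}
    (h : ∀ k, HasZeroTrace (I l) 1 (f k) (f' k))
    (hw : ∀ g, Tendsto (fun k => inner ℝ (f' k) g) atTop (𝓝 0)) {N : ℝ} (hN : ∀ k, ‖f' k‖ ≤ N) :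
    Tendsto (fun k => ‖f k‖) atTop (𝓝 0) := by
  have hfin : IsFiniteMeasure (volume.restrict (I l)) := ⟨by simp [I]⟩
  have hsq : Tendsto (fun k => ‖f k‖ ^ 2) atTop (𝓝 0) := by
    simp only [norm_sq_eq_integral]
    -- Pointwise values of `f k` are pairings of `f' k` with a fixed indicator, hence tend to zero;
    -- they are dominated by `√l * N`.
    have hdct := tendsto_integral_of_dominated_convergence (μ := volume.restrict (I l))
      (F := fun k x => (f k x) ^ 2) (f := fun _ => (0 : ℝ)) (fun _ => (√l * N) ^ 2)
      (fun k => (Lp.aestronglyMeasurable (f k)).pow 2) (integrable_const _) ?_ ?_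
    · simpa using hdct
    · intro k
      filter_upwards [(h k).ae_abs_le hl] with x hx
      rw [Real.norm_eq_abs, abs_pow]
      gcongr
      exact hx.trans (mul_le_mul_of_nonneg_left (hN k) (Real.sqrt_nonneg l))
    · filter_upwards [ae_all_iff.2 fun k => (h k).ae_eq_inner hl] with x hx
      simp only [hx]
      have := (hw (leftIndicator l x)).pow 2
      simpa [real_inner_comm] using this
  have := (Real.continuous_sqrt.tendsto 0).comp hsq
  rw [Real.sqrt_zero] at this
  exact this.congr fun k => Real.sqrt_sq (norm_nonneg _)

/-- The strain is quadratic in `w'`, but `w'` converges strongly by compactness. The quadratic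
remainder `r` thus tends to zero in norm, and the strain inherits the weak convergence of its linear
part. -/
theorem localSlope_le_liminf_of_weak (hl : 0 < l) {A B : Strain l →L[ℝ] Strain l} {K : ℝ}
    (hK : IsAlmostConvex
      (fun u : S1D uhat₁ uhat₂ vhat => A (strain u.1))
      (fun u : S1D uhat₁ uhat₂ vhat => B (strain u.1)) K)
    {z : ℕ → S1D uhat₁ uhat₂ vhat} {u : S1D uhat₁ uhat₂ vhat}
    (hz : ∀ f : Ambient l →L[ℝ] ℝ, Tendsto (fun k => f (z k).1) atTop (𝓝 (f u.1))) :
    localSlope (fun u v : S1D uhat₁ uhat₂ vhat => ‖B (strain u.1) - B (strain v.1)‖)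
        (fun u => 1 / 2 * ‖A (strain u.1)‖ ^ 2) u ≤
      liminf (fun i => localSlope
        (fun u v : S1D uhat₁ uhat₂ vhat => ‖B (strain u.1) - B (strain v.1)‖)
        (fun u => 1 / 2 * ‖A (strain u.1)‖ ^ 2) (z i)) atTop := by
  have hz0 : ∀ f : Ambient l →L[ℝ] ℝ, Tendsto (fun k => f ((z k).1 - u.1)) atTop (𝓝 0) :=
    fun f => by simpa using (hz f).sub_const (f u.1)
  have hbend : ∀ g, Tendsto (fun k => inner ℝ (((z k).1 - u.1).w.1 2) g) atTop (𝓝 0) := fun g => by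
    refine (hz0 (innerSL ℝ g ∘L WithLp.fstL 2 ℝ _ _ ∘L WithLp.sndL 2 ℝ _ _ ∘L linearStrain l)).congr
      fun k => ?_
    change inner ℝ g (((z k).1 - u.1).w.1 2) = _
    rw [real_inner_comm]
  obtain ⟨N, hN⟩ := exists_norm_le_of_weak (x₀ := (0 : L2I l)) (by simpa using hbend)
  have hs := tendsto_norm_of_hasZeroTrace hl (fun k => hasZeroTrace_deriv_sub (z k).2 u.2) hbend hN
  obtain ⟨C, hC⟩ := essBounded_deriv hl u.1.w
  set r : ℕ → Strain l := fun k => membrane (mulLift (u.1.w.1 1) (((z k).1 - u.1).w.1 1))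
    + defect ((z k).1 - u.1) with hr
  have hr0 : Tendsto r atTop (𝓝 0) := by
    refine squeeze_zero_norm (a := fun k => C * ‖((z k).1 - u.1).w.1 1‖
      + √l * N * ‖((z k).1 - u.1).w.1 1‖) (fun k => ?_) ?_
    · refine (norm_add_le _ _).trans (add_le_add ?_ ?_)
      · rw [norm_membrane]
        exact norm_mulLift_le hC _
      · rw [defect, norm_membrane, norm_smul]
        have hb : ‖mulLift (((z k).1 - u.1).w.1 1) (((z k).1 - u.1).w.1 1)‖
            ≤ √l * N * ‖((z k).1 - u.1).w.1 1‖ := by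
          refine norm_mulLift_le ?_ _
          filter_upwards [(hasZeroTrace_deriv_sub (z k).2 u.2).ae_abs_le hl] with x hx
          exact hx.trans (mul_le_mul_of_nonneg_left (hN k) (Real.sqrt_nonneg l))
        have hnn := norm_nonneg (mulLift (((z k).1 - u.1).w.1 1) (((z k).1 - u.1).w.1 1))
        have : ‖(1 / 2 : ℝ)‖ = 1 / 2 := by norm_num
        rw [this]
        linarith
    · simpa using (hs.const_mul C).add (hs.const_mul (√l * N))
  have hdec : ∀ k, strain (z k).1 = strain u.1 + linearStrain l ((z k).1 - u.1) + r k := fun k => by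
    have := strain_add_smul hl u.1 ((z k).1 - u.1) 1
    rw [one_smul, add_sub_cancel, one_smul, one_pow, one_smul] at this
    simp only [this, hr, defect]
    abel
  have hw : ∀ h, Tendsto (fun k => inner ℝ (strain (z k).1) h) atTop (𝓝 (inner ℝ (strain u.1) h)) := by
    intro h
    refine tendsto_inner_of_eq_add hdec (fun h => ?_) hr0 h
    exact hz0 (innerSL ℝ h ∘L linearStrain l)
  obtain ⟨N', hN'⟩ := exists_norm_le_of_weak hw
  exact localSlope_le_liminf_of_tendsto hl hK (Eventually.of_forall hN') hw hs

end S1D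

end VKRibbon

end

theorem lemma4p3 (l : ℝ) (hl : 0 < l)
    (QW QR : QuadraticForm ℝ (Matrix (Fin 2) (Fin 2) ℝ))
    (hW : IsAdmissibleForm QW) (hR : IsAdmissibleForm QR) :
    ∃ C₀ : ℝ, 0 < C₀ ∧ ∀ (uhat₁ : SobolevI l 1) (uhat₂ vhat : SobolevI l 2),
      -- representation of the local slope on sublevel sets
      (∀ C : ℝ, C₀ ≤ C → ∀ M : ℝ, 0 < M → ∀ u : S1D uhat₁ uhat₂ vhat, energy QW u.1 ≤ M →
        slope1D QW QR uhat₁ uhat₂ vhat u =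
          ⨆ (v : S1D uhat₁ uhat₂ vhat) (_ : u ≠ v),
            ENNReal.ofReal
              (max (energy QW u.1 - energy QW v.1 - Φ₂ C M (dissip QR u.1 v.1)) 0
                / Φ₁ C (dissip QR u.1 v.1))) ∧
      -- the local slope is a strong upper gradient
      IsStrongUpperGradient (fun u v : S1D uhat₁ uhat₂ vhat => dissip QR u.1 v.1)
        (fun u => energy QW u.1) (slope1D QW QR uhat₁ uhat₂ vhat) ∧
      -- the local slope is weakly sequentially lower semicontinuous
      (∀ (z : ℕ → S1D uhat₁ uhat₂ vhat) (u : S1D uhat₁ uhat₂ vhat),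
        Filter.Tendsto (fun k => toWeakSpace ℝ (Ambient l) (z k).1) Filter.atTop
          (nhds (toWeakSpace ℝ (Ambient l) u.1)) →
        slope1D QW QR uhat₁ uhat₂ vhat u ≤
          Filter.liminf (fun k => slope1D QW QR uhat₁ uhat₂ vhat (z k)) Filter.atTop) := by
  obtain ⟨A, B, K, L, hK, hB, hE, hD, hconv⟩ := exists_hilbert_model hl hW hR
  -- The threshold is that of `exists_descent`; `K` was fixed before the boundary data.
  refine ⟨2 * K ^ 2, by positivity, fun uhat₁ uhat₂ vhat => ?_⟩
  have hconv := hconv uhat₁ uhat₂ vhat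
  simp only [slope1D, hE, hD]
  refine ⟨fun C hC M _ u hM => hconv.localSlope_eq hC hM, ?_, fun z u hz => ?_⟩
  · refine hconv.isStrongUpperGradient fun ι F _ z u hz => ?_
    exact localSlope_le_liminf_of_strong hl hB hconv hz
  · refine localSlope_le_liminf_of_weak hl hconv fun f => ?_
    exact ((WeakBilin.eval_continuous (topDualPairing ℝ (Ambient l)).flip f).tendsto _).comp hz
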